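/- Let $n\ge 2$, let $N$ be a compact smooth $(n-1)$-dimensional manifold, with or without boundary, let $-\infty\le a<b\le+\infty$ and $M=(a,b)\times N$. Let $g=dr^2+G(r)$ be a smooth Riemannian metric on $M$, where $G(r)$, $r\in(a,b)$, is a family of Riemannian metrics on $N$, and let $g_0=dr^2+\mathring G(r)$ with $\mathring G(r)=\mathring h(r)^2\hat G$, where $\mathring h$ is a smooth positive function on $(a,b)$ and $\hat G$ is a fixed smooth Riemannian metric on $N$ with volume measure $\mu_{\hat G}$. Let $H$ and $\mathring H$ be the mean curvatures (traces of the Weingarten maps $X\mapsto\nabla_X\partial_r$) of the level sets $\{r\}\times N$ for $g$ and $g_0$, let $R_{rr}$ and $\mathring R_{rr}$ be the Ricci curvatures of $g$ and $g_0$ in the direction $(\partial_r,\partial_r)$, and set $$m(r,x)=\mathring h(r)^2\bigl(\mathring H(r,x)-H(r,x)\bigr),\qquad \mathcal M(r)=\int_N m(r,x)\,d\mu_{\hat G}(x).$$ Assume that the (finite) limits $\mathcal M(a)=\lim_{r\to a}\mathcal M(r)$ and $\mathcal M(b)=\lim_{r\to b}\mathcal M(r)$ exist, that $\mathring h^2(R_{rr}-\mathring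 R_{rr})\in L^1(M,dr\,d\mu_{\hat G})$, and that $$\int_M\mathring h^2(R_{rr}-\mathring R_{rr})\,dr\,d\mu_{\hat G}\ \ge\ 0 .$$ Then $\mathcal M(b)\ge\mathcal M(a)$, and $\mathcal M(b)=\mathcal M(a)$ if and only if there is a fixed Riemannian metric $\widetilde G$ on $N$ with $G(r)=\mathring h(r)^2\widetilde G$ for all $r\in(a,b)$. If moreover $g$ is asymptotic to $g_0$ at some $r_0\in[a,b]$, that is, $\|G(r)-\mathring G(r)\|_{\mathring G(r)}\to0$ uniformly on $N$ as $r\to r_0$ in $(a,b)$, then $\mathcal M(b)=\mathcal M(a)$ if and only if $g=g_0$. -/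

import Mathlib

open Set Filter Topology MeasureTheory Bundle
open scoped Manifold ContDiff

noncomputable section

namespace RadialMass

/-! ### Levi-Civita connection and Ricci curvature in coordinates

`V` is the space of coordinates, `D ⊆ V` the coordinate domain (relatively open in a half space
when there is a boundary), `e` the coordinate directions, `g` the matrix `(g_{ij})` of a metric. -/

section Coordinates

variable {V κ : Type*} [NormedAddCommGroup V] [NormedSpace ℝ V] [Fintype κ] [DecidableEq κ]

/-- The partial derivative `∂_i f`. -/
def partialD (D : Set V) (e : κ → V) (i : κ) (f : V → ℝ) (z : V) : ℝ :=
  fderivWithin ℝ f D z (e i)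

/-- `christoffel D e g k i j` is the Christoffel symbol `Γ^k_{ij}`, equal to
`½ g^{kl} (∂_i g_{jl} + ∂_j g_{il} - ∂_l g_{ij})`. -/
def christoffel (D : Set V) (e : κ → V) (g : V → Matrix κ κ ℝ) (k i j : κ) (z : V) : ℝ :=
  (1 / 2) * ∑ l, (g z)⁻¹ k l *
    (partialD D e i (fun w => g w j l) z + partialD D e j (fun w => g w i l) z
      - partialD D e l (fun w => g w i j) z)

/-- The Ricci tensor
`R_{ij} = ∂_k Γ^k_{ij} - ∂_j Γ^k_{ik} + Γ^k_{kl} Γ^l_{ij} - Γ^k_{jl} Γ^l_{ik}`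
(positive on round spheres). -/
def ricci (D : Set V) (e : κ → V) (g : V → Matrix κ κ ℝ) (i j : κ) (z : V) : ℝ :=
  (∑ k, partialD D e k (christoffel D e g k i j) z)
    - (∑ k, partialD D e j (christoffel D e g k i k) z)
    + (∑ k, ∑ l, christoffel D e g k k l z * christoffel D e g l i j z)
    - ∑ k, ∑ l, christoffel D e g k j l z * christoffel D e g l i k z

end Coordinates

section Manifold

variable {d : ℕ} {H : Type*} [TopologicalSpace H]
  (I : ModelWithCorners ℝ (EuclideanSpace ℝ (Fin d)) H)
  {N : Type*} [TopologicalSpace N] [ChartedSpace H N]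

/-- A field of bilinear forms on the tangent spaces of `N`. -/
abbrev BilinField (N : Type*) [TopologicalSpace N] [ChartedSpace H N] : Type _ :=
  (x : N) → TangentSpace I x →L[ℝ] TangentSpace I x →L[ℝ] ℝ

/-- A smooth Riemannian metric on `N`. -/
abbrev RiemMetric (N : Type*) [TopologicalSpace N] [ChartedSpace H N] [IsManifold I ∞ N] : Type _ :=
  ContMDiffRiemannianMetric (B := N) I ∞ (EuclideanSpace ℝ (Fin d)) (fun x : N => TangentSpace I x)

/-- The coordinate vector `∂_A` of the chart around `x₀`, at the point with coordinates `y`. -/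
def coordVector (x₀ : N) (y : EuclideanSpace ℝ (Fin d)) (A : Fin d) :
    TangentSpace I ((extChartAt I x₀).symm y) :=
  mfderivWithin 𝓘(ℝ, EuclideanSpace ℝ (Fin d)) I (extChartAt I x₀).symm (range I) y
    (EuclideanSpace.single A (1 : ℝ) : EuclideanSpace ℝ (Fin d))

/-- The matrix `B_{AB}(y) = B(∂_A, ∂_B)` of a field of bilinear forms in the chart around `x₀`. -/
def coordMatrix (B : BilinField I N) (x₀ : N) (y : EuclideanSpace ℝ (Fin d)) :
    Matrix (Fin d) (Fin d) ℝ :=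
  Matrix.of fun A C =>
    B ((extChartAt I x₀).symm y) (coordVector I x₀ y A) (coordVector I x₀ y C)

/-- The contribution of the chart around `c` to the Riemannian volume:
the push-forward to `N` of `ρ √(det G_{AB}) dy`. -/
def chartVolume [MeasurableSpace N] (B : BilinField I N) (ρ : N → ℝ) (c : N) : Measure N :=
  Measure.map (extChartAt I c).symm
    ((volume.restrict (extChartAt I c).target).withDensity fun y =>
      ENNReal.ofReal (ρ ((extChartAt I c).symm y) * √(coordMatrix I B c y).det))

variable (N) in
/-- Some smooth partition of unity subordinate to the charts of `N`. -/
def chartPartition [T2Space N] [SigmaCompactSpace N] [IsManifold I ∞ N] :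
    SmoothPartitionOfUnity N I N univ :=
  Classical.choose (SmoothPartitionOfUnity.exists_isSubordinate_chartAt_source I N)

/-- The Riemannian volume measure of a metric, `∑_c ρ_c √(det G_{AB}) dy` for a partition of unity
`(ρ_c)` subordinate to the charts. By the change of variables formula
it does not depend on the partition. -/
def riemannianVolume [T2Space N] [SigmaCompactSpace N] [IsManifold I ∞ N] [MeasurableSpace N]
    (G : RiemMetric I N) : Measure N :=
  Measure.sum fun c : N => chartVolume I G.inner (chartPartition I N c) c

/-! ### Metrics `dr² + G(r)` on `(a, b) × N`

The coordinates adapted to `M` are `(r, x^A)`; the index set is `Unit ⊕ Fin d`, the index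
`Sum.inl ()` being that of `r`. -/

/-- The coordinate domain `ℝ × φ(U)` for the chart `φ : U → φ(U)` of `N` around `x₀`. -/
def adaptedDomain (x₀ : N) : Set (ℝ × EuclideanSpace ℝ (Fin d)) :=
  univ ×ˢ (extChartAt I x₀).target

/-- The coordinate directions of `(r, x^A)`. -/
def adaptedFrame (d : ℕ) : Unit ⊕ Fin d → ℝ × EuclideanSpace ℝ (Fin d)
  | Sum.inl _ => (1, 0)
  | Sum.inr A => (0, EuclideanSpace.single A (1 : ℝ))

/-- The matrix of the metric `dr² + G(r)` in the coordinates `(r, x^A)`, for the chart of `N`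
around `x₀`. -/
def adaptedMatrix (G : ℝ → BilinField I N) (x₀ : N) (z : ℝ × EuclideanSpace ℝ (Fin d)) :
    Matrix (Unit ⊕ Fin d) (Unit ⊕ Fin d) ℝ :=
  Matrix.fromBlocks 1 0 0 (coordMatrix I (G z.1) x₀ z.2)

/-- The Ricci curvature `R_{rr}` of `dr² + G(r)` in the direction `(∂_r, ∂_r)` at `(r, x)`. -/
def ricciRR (G : ℝ → BilinField I N) (r : ℝ) (x : N) : ℝ :=
  ricci (adaptedDomain I x) (adaptedFrame d) (adaptedMatrix I G x) (Sum.inl ()) (Sum.inl ())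
    (r, extChartAt I x x)

/-- The Weingarten map `X ↦ ∇_X ∂_r` of the level set `N(r)` with respect to the unit normal `∂_r`,
for `dr² + G(r)`, at `(r, x)`: its entries are `S^B_A = Γ^B_{Ar}`. -/
def weingarten (G : ℝ → BilinField I N) (r : ℝ) (x : N) : Matrix (Fin d) (Fin d) ℝ :=
  Matrix.of fun B A =>
    christoffel (adaptedDomain I x) (adaptedFrame d) (adaptedMatrix I G x)
      (Sum.inr B) (Sum.inr A) (Sum.inl ()) (r, extChartAt I x x)

/-- The mean curvature of the level set `N(r)` for `dr² + G(r)`, at `(r, x)`. -/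
def meanCurvature (G : ℝ → BilinField I N) (r : ℝ) (x : N) : ℝ :=
  (weingarten I G r x).trace

/-- The family `r ↦ h(r)² Ĝ`. -/
def warped (h : ℝ → ℝ) (B : BilinField I N) : ℝ → BilinField I N :=
  fun r x => (h r) ^ 2 • B x

/-- The radial mass `m(r, x)` of `dr² + G(r)` relative to `dr² + h² Ĝ`. -/
def mass (h : ℝ → ℝ) (Ghat : BilinField I N) (G : ℝ → BilinField I N) (r : ℝ) (x : N) : ℝ :=
  (h r) ^ 2 * (meanCurvature I (warped I h Ghat) r x - meanCurvature I G r x)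

/-- The radial mass of `dr² + G(r)` relative to `dr² + h² Ĝ` on `N(r)`. -/
def totalMass [T2Space N] [SigmaCompactSpace N] [IsManifold I ∞ N] [MeasurableSpace N]
    (h : ℝ → ℝ) (Ghat : RiemMetric I N) (G : ℝ → BilinField I N) (r : ℝ) : ℝ :=
  ∫ x, mass I h Ghat.inner G r x ∂(riemannianVolume I Ghat)

/-- The function `h² (R_{rr} - R̊_{rr})` on `(a, b) × N`. -/
def ricciDefect (h : ℝ → ℝ) (Ghat : BilinField I N) (G : ℝ → BilinField I N) (p : ℝ × N) : ℝ :=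
  (h p.1) ^ 2 * (ricciRR I G p.1 p.2 - ricciRR I (warped I h Ghat) p.1 p.2)

end Manifold

/-- The real points of the interval `(a, b)`, whose ends may be infinite. -/
def openInterval (a b : EReal) : Set ℝ := {r : ℝ | a < r ∧ r < b}

/-- The filter of the real numbers `r ∈ (a, b)` tending to `c ∈ [a, b]`. -/
def nearIn (a b c : EReal) : Filter ℝ := comap Real.toEReal (𝓝[Ioo a b] c)

section Asymptotic

variable {d : ℕ} {H : Type*} [TopologicalSpace H]
  (I : ModelWithCorners ℝ (EuclideanSpace ℝ (Fin d)) H)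
  {N : Type*} [TopologicalSpace N] [ChartedSpace H N]

/-- The family `G(r)` of metrics on `N` is of class `C^∞` in `(r, x) ∈ (a, b) × N`. -/
def SmoothFamily [IsManifold I ∞ N] (a b : EReal) (G : ℝ → BilinField I N) : Prop :=
  ContMDiffOn (𝓘(ℝ, ℝ).prod I)
    (I.prod 𝓘(ℝ, EuclideanSpace ℝ (Fin d) →L[ℝ] EuclideanSpace ℝ (Fin d) →L[ℝ] ℝ)) ∞
    (fun p : ℝ × N =>
      (TotalSpace.mk' (EuclideanSpace ℝ (Fin d) →L[ℝ] EuclideanSpace ℝ (Fin d) →L[ℝ] ℝ)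
        (E := fun x : N => TangentSpace I x →L[ℝ] TangentSpace I x →L[ℝ] ℝ) p.2 (G p.1 p.2)))
    (openInterval a b ×ˢ univ)

/-- `‖G - G₀‖_{G₀} = o(1)` as `r → c` in `(a, b)`, uniformly on `N`. The norm with respect to `G₀`
of the bilinear form `T` is the least `ε` with `|T(u, v)| ≤ ε |u|_{G₀} |v|_{G₀}`. -/
def AsymptoticAt (a b c : EReal) (G G₀ : ℝ → BilinField I N) : Prop :=
  ∀ ε : ℝ, 0 < ε → ∀ᶠ r in nearIn a b c, ∀ (x : N) (u v : TangentSpace I x),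
    |G r x u v - G₀ r x u v| ≤ ε * √(G₀ r x u u) * √(G₀ r x v v)

end Asymptotic

end RadialMass

end

/-!
Let `S = ½ G⁻¹ ∂_r G` be the Weingarten map of the level sets. In the coordinates `(r, x^A)` the
radial Ricci curvature is given by the Riccati equation `R_rr = -∂_r H - tr S²`. Subtracting its
instance for the warped metric, where `S̊ = (h' / h) · 1`, gives
`∂_r m = h² (R_rr - R̊_rr) + h² tr ((S - S̊)²)`. The last term is nonnegative because `S` is
self-adjoint for `G`, so integrating over `(a, b) × N` yields the inequality. Equality forces
`S = S̊`, that is `∂_r G = 2 (h' / h) G`, so that `h⁻² G` does not depend on `r`; if `G` is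
asymptotic to `h² Ĝ`, this constant metric is `Ĝ`.
-/

noncomputable section

namespace RadialMass

/-! ### Traces of squares of matrices -/

section Trace

open scoped Matrix

variable {κ 𝕜 : Type*} [Fintype κ] [RCLike 𝕜]

theorem trace_conjTranspose_mul_mul_sq (L : Matrix κ κ 𝕜) {B : Matrix κ κ 𝕜}
    (hB : B.IsHermitian) :
    (Lᴴ * L * B * (Lᴴ * L * B)).trace = ((L * B * Lᴴ)ᴴ * (L * B * Lᴴ)).trace := by
  rw [(Matrix.isHermitian_mul_mul_conjTranspose L hB).eq, Matrix.mul_assoc Lᴴ L B,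
    Matrix.mul_assoc Lᴴ, Matrix.trace_mul_comm]
  simp only [Matrix.mul_assoc]

open scoped ComplexOrder MatrixOrder Matrix.Norms.L2Operator in
theorem exists_eq_conjTranspose_mul_self_of_posSemidef {C : Matrix κ κ 𝕜} (hC : C.PosSemidef) :
    ∃ L : Matrix κ κ 𝕜, C = Lᴴ * L := by
  classical exact CStarAlgebra.nonneg_iff_eq_star_mul_self.1 hC.nonneg

open scoped ComplexOrder in
theorem trace_mul_sq_nonneg {C B : Matrix κ κ 𝕜} (hC : C.PosSemidef) (hB : B.IsHermitian) :
    0 ≤ (C * B * (C * B)).trace := by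
  obtain ⟨L, rfl⟩ := exists_eq_conjTranspose_mul_self_of_posSemidef hC
  rw [trace_conjTranspose_mul_mul_sq L hB]
  exact (Matrix.posSemidef_conjTranspose_mul_self _).trace_nonneg

open scoped ComplexOrder in
theorem trace_mul_sq_eq_zero_iff {C B : Matrix κ κ 𝕜} (hC : C.PosDef) (hB : B.IsHermitian) :
    (C * B * (C * B)).trace = 0 ↔ B = 0 := by
  classical
  obtain ⟨L, rfl⟩ := exists_eq_conjTranspose_mul_self_of_posSemidef hC.posSemidef
  have hLH : IsUnit Lᴴ := isUnit_of_mul_isUnit_left hC.isUnit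
  have hL : IsUnit L := isUnit_of_mul_isUnit_right hC.isUnit
  rw [trace_conjTranspose_mul_mul_sq L hB, Matrix.trace_conjTranspose_mul_self_eq_zero_iff,
    hLH.mul_left_eq_zero, hL.mul_right_eq_zero]

end Trace

section ShiftedSquare

variable {κ R : Type*} [Fintype κ] [DecidableEq κ] [CommRing R]

theorem trace_sub_smul_one_sq (S : Matrix κ κ R) (c : R) :
    ((S - c • 1) * (S - c • 1)).trace
      = (S * S).trace - 2 * c * S.trace + c ^ 2 * Fintype.card κ := by
  have hexpand : (S - c • 1) * (S - c • 1) = S * S - (2 * c) • S + c ^ 2 • 1 := by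
    simp only [Matrix.sub_mul, Matrix.mul_sub, Matrix.mul_smul, Matrix.smul_mul, Matrix.mul_one,
      Matrix.one_mul]
    module
  rw [hexpand, Matrix.trace_add, Matrix.trace_sub, Matrix.trace_smul, Matrix.trace_smul,
    Matrix.trace_one, smul_eq_mul, smul_eq_mul]

end ShiftedSquare

/-! ### Calculus of matrix-valued functions -/

section MatrixCalculus

open scoped Matrix Matrix.Norms.Operator

variable {κ W : Type*} [Fintype κ] [NormedAddCommGroup W] [NormedSpace ℝ W]
  {s : Set W} {m : WithTop ℕ∞}

theorem contDiffOn_matrix_iff {γ : W → Matrix κ κ ℝ} :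
    ContDiffOn ℝ m γ s ↔ ∀ A C, ContDiffOn ℝ m (fun w => γ w A C) s := by
  classical
  refine ⟨fun hγ A C =>
    (Matrix.entryLinearMap ℝ ℝ A C).toContinuousLinearMap.contDiff.comp_contDiffOn hγ,
    fun hγ => ?_⟩
  have hsum : γ = fun w => ∑ A, ∑ C, γ w A C • Matrix.single A C (1 : ℝ) := by
    ext1 w
    conv_lhs => rw [Matrix.matrix_eq_sum_single (γ w)]
    simp only [Matrix.smul_single, smul_eq_mul, mul_one]
  rw [hsum]
  exact ContDiffOn.sum fun A _ => ContDiffOn.sum fun C _ => (hγ A C).smul contDiffOn_const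

theorem contDiffOn_matrix_trace {γ : W → Matrix κ κ ℝ} (hγ : ContDiffOn ℝ m γ s) :
    ContDiffOn ℝ m (fun w => (γ w).trace) s :=
  (Matrix.traceLinearMap κ ℝ ℝ).toContinuousLinearMap.contDiff.comp_contDiffOn hγ

theorem contDiffOn_matrix_inv [DecidableEq κ] {γ : W → Matrix κ κ ℝ} (hγ : ContDiffOn ℝ m γ s)
    (hu : ∀ w ∈ s, IsUnit (γ w)) : ContDiffOn ℝ m (fun w => (γ w)⁻¹) s := by
  intro w hw
  obtain ⟨u, hu⟩ := hu w hw
  simp only [Matrix.nonsing_inv_eq_ringInverse]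
  exact (hu ▸ contDiffAt_ringInverse ℝ u).comp_contDiffWithinAt w (hγ w hw)

variable {r : ℝ}

theorem deriv_matrix_trace {γ : ℝ → Matrix κ κ ℝ} (hγ : DifferentiableAt ℝ γ r) :
    deriv (fun s => (γ s).trace) r = (deriv γ r).trace :=
  ((Matrix.traceLinearMap κ ℝ ℝ).toContinuousLinearMap.hasFDerivAt.comp_hasDerivAt r
    hγ.hasDerivAt).deriv

omit [Fintype κ]

variable [Finite κ] {γ : ℝ → Matrix κ κ ℝ}

theorem deriv_matrix_apply (hγ : DifferentiableAt ℝ γ r) (A C : κ) :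
    deriv γ r A C = deriv (fun s => γ s A C) r := by
  have := Fintype.ofFinite κ
  exact ((Matrix.entryLinearMap ℝ ℝ A C).toContinuousLinearMap.hasFDerivAt.comp_hasDerivAt r
    hγ.hasDerivAt).deriv.symm

theorem isSymm_deriv (hγ : DifferentiableAt ℝ γ r) (hsymm : ∀ᶠ s in 𝓝 r, (γ s).IsSymm) :
    (deriv γ r).IsSymm := by
  have := Fintype.ofFinite κ
  have htranspose : deriv (fun s => (γ s)ᵀ) r = (deriv γ r)ᵀ :=
    ((Matrix.transposeLinearEquiv κ κ ℝ ℝ).toContinuousLinearEquiv.hasFDerivAt.comp_hasDerivAt r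
      hγ.hasDerivAt).deriv
  exact htranspose.symm.trans (EventuallyEq.deriv_eq hsymm)

theorem isHermitian_half_deriv_sub_smul (hγ : DifferentiableAt ℝ γ r)
    (hpos : ∀ᶠ s in 𝓝 r, (γ s).PosDef) (c : ℝ) :
    ((1 / 2 : ℝ) • deriv γ r - c • γ r).IsHermitian := by
  have hsymm : ∀ᶠ s in 𝓝 r, (γ s).IsSymm :=
    hpos.mono fun s hs => Matrix.isHermitian_iff_isSymm.1 hs.isHermitian
  exact Matrix.isHermitian_iff_isSymm.2
    (((isSymm_deriv hγ hsymm).smul _).sub (hsymm.self_of_nhds.smul _))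

end MatrixCalculus

/-! ### The shape operator of a path of metrics -/

section Shape

open scoped Matrix Matrix.Norms.Operator

variable {κ : Type*} [Fintype κ] [DecidableEq κ]

/-- The shape operator `½ γ⁻¹ ∂_r γ` of the level sets of `dr² + γ(r)`. -/
def shape (γ : ℝ → Matrix κ κ ℝ) (r : ℝ) : Matrix κ κ ℝ :=
  (1 / 2 : ℝ) • ((γ r)⁻¹ * deriv γ r)

variable {γ γ' : ℝ → Matrix κ κ ℝ} {r : ℝ}

theorem shape_congr (h : γ =ᶠ[𝓝 r] γ') : shape γ r = shape γ' r := by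
  have hderiv : deriv γ r = deriv γ' r := h.deriv_eq
  rw [shape, shape, h.eq_of_nhds, hderiv]

theorem shape_conj (hγ : DifferentiableAt ℝ γ r) {P : Matrix κ κ ℝ} (hP : IsUnit P) :
    shape (fun s => Pᵀ * γ s * P) r = P⁻¹ * shape γ r * P := by
  have hcancel : Pᵀ⁻¹ * Pᵀ = 1 :=
    Matrix.nonsing_inv_mul _ ((Matrix.isUnit_iff_isUnit_det _).1 ((Matrix.isUnit_transpose P).2 hP))
  have hderiv : deriv (fun s => Pᵀ * γ s * P) r = Pᵀ * deriv γ r * P :=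
    ((hγ.hasDerivAt.const_mul Pᵀ).mul_const P).deriv
  rw [shape, shape, hderiv, Matrix.mul_inv_rev, Matrix.mul_inv_rev, Matrix.mul_smul,
    Matrix.smul_mul]
  congr 1
  calc P⁻¹ * ((γ r)⁻¹ * Pᵀ⁻¹) * (Pᵀ * deriv γ r * P)
      = P⁻¹ * (γ r)⁻¹ * (Pᵀ⁻¹ * Pᵀ) * deriv γ r * P := by simp only [Matrix.mul_assoc]
    _ = P⁻¹ * ((γ r)⁻¹ * deriv γ r) * P := by
      simp only [hcancel, Matrix.mul_one, Matrix.mul_assoc]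

theorem shape_sq_smul_const {h : ℝ → ℝ} (hd : DifferentiableAt ℝ h r) (hr : h r ≠ 0)
    {g : Matrix κ κ ℝ} (hg : IsUnit g) :
    shape (fun s => h s ^ 2 • g) r = (deriv h r / h r) • 1 := by
  have hdet : IsUnit g.det := (Matrix.isUnit_iff_isUnit_det g).1 hg
  have hderiv : deriv (fun s => h s ^ 2 • g) r = (2 * h r * deriv h r) • g :=
    (((hd.hasDerivAt.fun_pow 2).smul_const g).congr_deriv (by simp)).deriv
  have hinv : (h r ^ 2 • g)⁻¹ = (h r ^ 2)⁻¹ • g⁻¹ :=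
    Matrix.inv_smul' g (Units.mk0 (h r ^ 2) (pow_ne_zero 2 hr)) hdet
  rw [shape, hderiv, hinv, Matrix.smul_mul, Matrix.mul_smul, smul_smul, smul_smul,
    Matrix.nonsing_inv_mul _ hdet]
  congr 1
  field_simp

theorem shape_sub_smul_one (hu : IsUnit (γ r)) (c : ℝ) :
    shape γ r - c • 1 = (γ r)⁻¹ * ((1 / 2 : ℝ) • deriv γ r - c • γ r) := by
  rw [Matrix.mul_sub, Matrix.mul_smul, Matrix.mul_smul,
    Matrix.nonsing_inv_mul _ ((Matrix.isUnit_iff_isUnit_det _).1 hu), shape]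

theorem trace_shape_sub_sq_nonneg (hγ : DifferentiableAt ℝ γ r)
    (hpos : ∀ᶠ s in 𝓝 r, (γ s).PosDef) (c : ℝ) :
    0 ≤ ((shape γ r - c • 1) * (shape γ r - c • 1)).trace := by
  rw [shape_sub_smul_one hpos.self_of_nhds.isUnit]
  exact trace_mul_sq_nonneg hpos.self_of_nhds.inv.posSemidef
    (isHermitian_half_deriv_sub_smul hγ hpos c)

theorem trace_shape_sub_sq_eq_zero_iff (hγ : DifferentiableAt ℝ γ r)
    (hpos : ∀ᶠ s in 𝓝 r, (γ s).PosDef) (c : ℝ) :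
    ((shape γ r - c • 1) * (shape γ r - c • 1)).trace = 0 ↔ deriv γ r = (2 * c) • γ r := by
  rw [shape_sub_smul_one hpos.self_of_nhds.isUnit,
    trace_mul_sq_eq_zero_iff hpos.self_of_nhds.inv (isHermitian_half_deriv_sub_smul hγ hpos c),
    sub_eq_zero, mul_smul, ← (smul_right_injective _ (two_ne_zero' ℝ)).eq_iff, smul_smul]
  norm_num

end Shape

/-! ### Functions on `J × T` -/

section Slice

variable {E F : Type*} [NormedAddCommGroup E] [NormedSpace ℝ E] [NormedAddCommGroup F]
  [NormedSpace ℝ F] {J : Set ℝ} {T : Set F} {f : ℝ × F → E} {r : ℝ} {y : F} {m n : WithTop ℕ∞}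

theorem hasDerivAt_slice (hJ : IsOpen J) (hr : r ∈ J) (hy : y ∈ T) {f' : ℝ × F →L[ℝ] E}
    (hf : HasFDerivWithinAt f f' (J ×ˢ T) (r, y)) :
    HasDerivAt (fun s => f (s, y)) (f' (1, 0)) r := by
  have hslice : HasDerivWithinAt (fun s : ℝ => (s, y)) ((1 : ℝ), (0 : F)) J r :=
    ((hasDerivAt_id r).prodMk (hasDerivAt_const r y)).hasDerivWithinAt
  exact (hf.comp_hasDerivWithinAt r hslice fun s hs => mk_mem_prod hs hy).hasDerivAt
    (hJ.mem_nhds hr)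

theorem deriv_slice_eq_fderivWithin (hJ : IsOpen J) (hf : DifferentiableOn ℝ f (J ×ˢ T))
    (hr : r ∈ J) (hy : y ∈ T) :
    deriv (fun s => f (s, y)) r = fderivWithin ℝ f (J ×ˢ T) (r, y) (1, 0) :=
  (hasDerivAt_slice hJ hr hy (hf _ ⟨hr, hy⟩).hasFDerivWithinAt).deriv

theorem differentiableAt_slice (hJ : IsOpen J) (hf : DifferentiableOn ℝ f (J ×ˢ T))
    (hr : r ∈ J) (hy : y ∈ T) : DifferentiableAt ℝ (fun s => f (s, y)) r :=
  (hasDerivAt_slice hJ hr hy (hf _ ⟨hr, hy⟩).hasFDerivWithinAt).differentiableAt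

theorem contDiffOn_deriv_slice (hJ : IsOpen J) (hT : UniqueDiffOn ℝ T)
    (hf : ContDiffOn ℝ n f (J ×ˢ T)) (hmn : m + 1 ≤ n) :
    ContDiffOn ℝ m (fun z : ℝ × F => deriv (fun s => f (s, z.2)) z.1) (J ×ˢ T) := by
  have hdiff : DifferentiableOn ℝ f (J ×ˢ T) :=
    hf.differentiableOn (one_pos.trans_le (le_add_self.trans hmn)).ne'
  exact ((hf.fderivWithin (hJ.uniqueDiffOn.prod hT) hmn).clm_apply contDiffOn_const).congr
    fun z hz => deriv_slice_eq_fderivWithin hJ hdiff hz.1 hz.2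

end Slice

section ShapeSlice

open scoped Matrix Matrix.Norms.Operator

variable {κ F : Type*} [Fintype κ] [DecidableEq κ] [NormedAddCommGroup F] [NormedSpace ℝ F]
  {J : Set ℝ} {T : Set F} {m n : WithTop ℕ∞}

theorem contDiffOn_shape {γ : ℝ × F → Matrix κ κ ℝ} (hJ : IsOpen J) (hT : UniqueDiffOn ℝ T)
    (hγ : ContDiffOn ℝ n γ (J ×ˢ T)) (hu : ∀ z ∈ J ×ˢ T, IsUnit (γ z)) (hmn : m + 1 ≤ n) :
    ContDiffOn ℝ m (fun z : ℝ × F => shape (fun s => γ (s, z.2)) z.1) (J ×ˢ T) :=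
  (((contDiffOn_matrix_inv hγ hu).of_le (le_self_add.trans hmn)).mul
    (contDiffOn_deriv_slice hJ hT hγ hmn)).const_smul _

end ShapeSlice

/-! ### Curvature of `dr² + γ` in adapted coordinates -/

section AdaptedCurvature

open scoped Matrix Matrix.Norms.Operator

variable {d : ℕ} {T : Set (EuclideanSpace ℝ (Fin d))} {J : Set ℝ} {r : ℝ}
  {y : EuclideanSpace ℝ (Fin d)} {D : Set (ℝ × EuclideanSpace ℝ (Fin d))}
  {z : ℝ × EuclideanSpace ℝ (Fin d)}
  {γ : ℝ × EuclideanSpace ℝ (Fin d) → Matrix (Fin d) (Fin d) ℝ}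

/-- The matrix of the metric `dr² + γ` in coordinates `(r, x^A)`, where `γ` may depend on `r`. -/
def radialMetric {V : Type*} (γ : V → Matrix (Fin d) (Fin d) ℝ) (z : V) :
    Matrix (Unit ⊕ Fin d) (Unit ⊕ Fin d) ℝ :=
  Matrix.fromBlocks 1 0 0 (γ z)

theorem partialD_const {V κ : Type*} [NormedAddCommGroup V] [NormedSpace ℝ V]
    (D : Set V) (e : κ → V) (i : κ) (c : ℝ) (z : V) : partialD D e i (fun _ => c) z = 0 := by
  simp [partialD]

theorem partialD_inl_eq_deriv (hJ : IsOpen J) {f : ℝ × EuclideanSpace ℝ (Fin d) → ℝ}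
    (hf : DifferentiableOn ℝ f (J ×ˢ T)) (hr : r ∈ J) (hy : y ∈ T) :
    partialD (univ ×ˢ T) (adaptedFrame d) (Sum.inl ()) f (r, y)
      = deriv (fun s => f (s, y)) r := by
  have hD : J ×ˢ T = (univ ×ˢ T) ∩ Prod.fst ⁻¹' J := by
    ext
    simp [and_comm]
  rw [deriv_slice_eq_fderivWithin hJ hf hr hy, partialD, hD,
    fderivWithin_inter ((hJ.preimage continuous_fst).mem_nhds hr)]
  rfl

theorem inv_fromBlocks_one {M : Matrix (Fin d) (Fin d) ℝ} (hM : IsUnit M) :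
    (Matrix.fromBlocks (1 : Matrix Unit Unit ℝ) 0 0 M)⁻¹ = Matrix.fromBlocks 1 0 0 M⁻¹ := by
  rw [Matrix.inv_fromBlocks_zero₂₁_of_isUnit_iff _ _ _ (by simp [hM])]
  simp

theorem christoffel_radial_radial (k : Unit ⊕ Fin d) :
    christoffel D (adaptedFrame d) (radialMetric γ) k
      (Sum.inl ()) (Sum.inl ()) = 0 := by
  ext z
  simp [christoffel, radialMetric, partialD_const]

theorem christoffel_inl_radial (hz : IsUnit (γ z)) (k : Unit ⊕ Fin d) :
    christoffel D (adaptedFrame d) (radialMetric γ) (Sum.inl ())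
      (Sum.inl ()) k z = 0 := by
  rcases k with k | k <;> simp [christoffel, radialMetric, inv_fromBlocks_one hz, partialD_const]

theorem christoffel_inr_radial (hz : IsUnit (γ z)) (B A : Fin d) :
    christoffel D (adaptedFrame d) (radialMetric γ) (Sum.inr B)
      (Sum.inl ()) (Sum.inr A) z
      = (1 / 2) * ∑ C, (γ z)⁻¹ B C *
        partialD D (adaptedFrame d) (Sum.inl ()) (fun w => γ w A C) z := by
  simp [christoffel, radialMetric, inv_fromBlocks_one hz, partialD_const]

theorem christoffel_radial_comm (hz : IsUnit (γ z)) (B A : Fin d) :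
    christoffel D (adaptedFrame d) (radialMetric γ) (Sum.inr B)
      (Sum.inr A) (Sum.inl ()) z
      = christoffel D (adaptedFrame d) (radialMetric γ) (Sum.inr B)
        (Sum.inl ()) (Sum.inr A) z := by
  simp [christoffel, radialMetric, inv_fromBlocks_one hz, partialD_const]

section Regular

variable (hJ : IsOpen J) (hu : ∀ z ∈ J ×ˢ T, IsUnit (γ z)) (hsymm : ∀ z ∈ J ×ˢ T, (γ z).IsSymm)

include hJ hu hsymm

theorem christoffel_inr_radial_eq_shape (hγ : DifferentiableOn ℝ γ (J ×ˢ T)) (hr : r ∈ J)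
    (hy : y ∈ T) (B A : Fin d) :
    christoffel (univ ×ˢ T) (adaptedFrame d) (radialMetric γ)
      (Sum.inr B) (Sum.inl ()) (Sum.inr A) (r, y) = shape (fun s => γ (s, y)) r B A := by
  have hdiff : DifferentiableAt ℝ (fun s => γ (s, y)) r := differentiableAt_slice hJ hγ hr hy
  have hsymm' : (deriv (fun s => γ (s, y)) r).IsSymm := isSymm_deriv hdiff <| by
    filter_upwards [hJ.mem_nhds hr] with s hs using hsymm _ ⟨hs, hy⟩
  have hentry (A C : Fin d) : DifferentiableOn ℝ (fun w => γ w A C) (J ×ˢ T) :=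
    (Matrix.entryLinearMap ℝ ℝ A C).toContinuousLinearMap.differentiable.comp_differentiableOn hγ
  rw [christoffel_inr_radial (hu _ ⟨hr, hy⟩), shape, Matrix.smul_apply, Matrix.mul_apply,
    smul_eq_mul]
  congr 1
  refine Finset.sum_congr rfl fun C _ => ?_
  rw [partialD_inl_eq_deriv hJ (hentry A C) hr hy, ← hsymm'.apply C A,
    deriv_matrix_apply hdiff]

theorem partialD_christoffel_inr_radial (hT : UniqueDiffOn ℝ T) (hγ : ContDiffOn ℝ 2 γ (J ×ˢ T))
    (hr : r ∈ J) (hy : y ∈ T) (B A : Fin d) :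
    partialD (univ ×ˢ T) (adaptedFrame d) (Sum.inl ())
      (christoffel (univ ×ˢ T) (adaptedFrame d) (radialMetric γ)
        (Sum.inr B) (Sum.inl ()) (Sum.inr A)) (r, y)
      = deriv (fun s => shape (fun t => γ (t, y)) s B A) r := by
  have hchristoffel (z) (hz : z ∈ J ×ˢ T) :
      christoffel (univ ×ˢ T) (adaptedFrame d) (radialMetric γ)
        (Sum.inr B) (Sum.inl ()) (Sum.inr A) z = shape (fun s => γ (s, z.2)) z.1 B A :=
    christoffel_inr_radial_eq_shape hJ hu hsymm (hγ.differentiableOn two_ne_zero) hz.1 hz.2 B A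
  have hshape : ContDiffOn ℝ 1 (fun z : ℝ × _ => shape (fun s => γ (s, z.2)) z.1) (J ×ˢ T) :=
    contDiffOn_shape hJ hT hγ hu one_add_one_eq_two.le
  rw [partialD_inl_eq_deriv hJ (((contDiffOn_matrix_iff.1 hshape B A).congr
    hchristoffel).differentiableOn one_ne_zero) hr hy]
  refine EventuallyEq.deriv_eq ?_
  filter_upwards [hJ.mem_nhds hr] with s hs using hchristoffel (s, y) ⟨hs, hy⟩

theorem ricci_radial_eq_riccati (hT : UniqueDiffOn ℝ T) (hγ : ContDiffOn ℝ 2 γ (J ×ˢ T))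
    (hr : r ∈ J) (hy : y ∈ T) :
    ricci (univ ×ˢ T) (adaptedFrame d) (radialMetric γ)
      (Sum.inl ()) (Sum.inl ()) (r, y)
      = - deriv (fun s => (shape (fun t => γ (t, y)) s).trace) r
        - (shape (fun s => γ (s, y)) r * shape (fun s => γ (s, y)) r).trace := by
  have hz : IsUnit (γ (r, y)) := hu _ ⟨hr, hy⟩
  have hdiff : DifferentiableAt ℝ (fun s => shape (fun t => γ (t, y)) s) r :=
    differentiableAt_slice hJ ((contDiffOn_shape (m := 1) hJ hT hγ hu
      one_add_one_eq_two.le).differentiableOn one_ne_zero) hr hy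
  have hdγ : DifferentiableOn ℝ γ (J ×ˢ T) := hγ.differentiableOn two_ne_zero
  have hzero (k) : partialD (univ ×ˢ T) (adaptedFrame d) k 0 (r, y) = 0 :=
    partialD_const _ _ k 0 _
  simp only [ricci, Fintype.sum_sum_type, Finset.univ_unique, PUnit.default_eq_unit,
    Finset.sum_singleton, christoffel_radial_radial, christoffel_inl_radial hz,
    christoffel_inr_radial_eq_shape hJ hu hsymm hdγ hr hy, hzero,
    partialD_christoffel_inr_radial hJ hu hsymm hT hγ hr hy]
  rw [deriv_matrix_trace hdiff]
  simp [Matrix.trace, Matrix.mul_apply, deriv_matrix_apply hdiff]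

end Regular

end AdaptedCurvature

/-! ### Bilinear forms in charts -/

section Charts

open scoped Matrix Matrix.Norms.Operator

variable {d : ℕ} {H : Type*} [TopologicalSpace H]
  {I : ModelWithCorners ℝ (EuclideanSpace ℝ (Fin d)) H}
  {N : Type*} [TopologicalSpace N] [ChartedSpace H N]

theorem bilinField_congr (B : BilinField I N) {x x' : N} (h : x' = x)
    (u v : EuclideanSpace ℝ (Fin d)) :
    B x' (show TangentSpace I x' from u) (show TangentSpace I x' from v)
      = B x (show TangentSpace I x from u) (show TangentSpace I x from v) := by
  subst h
  rfl

theorem extChartAt_symm_mem_source {x₀ : N} {y : EuclideanSpace ℝ (Fin d)}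
    (hy : y ∈ (extChartAt I x₀).target) :
    (extChartAt I x₀).symm y ∈ (chartAt H x₀).source :=
  extChartAt_source I x₀ ▸ (extChartAt I x₀).map_target hy

theorem extChartAt_mem_target {x₀ x : N} (hx : x ∈ (chartAt H x₀).source) :
    extChartAt I x₀ x ∈ (extChartAt I x₀).target :=
  (extChartAt I x₀).map_source ((extChartAt_source I x₀).symm ▸ hx)

variable [IsManifold I ∞ N]

variable (I) in
/-- The coordinate basis of `T_x N` for the chart around `x₀`. -/
def chartBasis {x₀ x : N} (hx : x ∈ (chartAt H x₀).source) :
    Module.Basis (Fin d) ℝ (TangentSpace I x) :=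
  (trivializationAt (EuclideanSpace ℝ (Fin d)) (TangentSpace I) x₀).basisAt
    (EuclideanSpace.basisFun (Fin d) ℝ).toBasis (x := x) (by simpa using hx)

theorem chartBasis_apply {x₀ x : N} (hx : x ∈ (chartAt H x₀).source) (A : Fin d) :
    chartBasis I hx A = (trivializationAt (EuclideanSpace ℝ (Fin d))
      (TangentSpace I) x₀).symmL ℝ x (EuclideanSpace.single A (1 : ℝ)) := by
  rw [Trivialization.symmL_apply _ (by simpa using hx)]
  simp [chartBasis, Trivialization.basisAt]

theorem coordMatrix_apply_chart (B : BilinField I N) {x₀ x : N}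
    (hx : x ∈ (chartAt H x₀).source) (A C : Fin d) :
    coordMatrix I B x₀ (extChartAt I x₀ x) A C
      = B x (chartBasis I hx A) (chartBasis I hx C) := by
  rw [chartBasis_apply, chartBasis_apply, TangentBundle.symmL_trivializationAt hx]
  exact bilinField_congr B ((extChartAt I x₀).left_inv (by simpa using hx)) _ _

theorem coordMatrix_eq_toMatrix (B : BilinField I N) {x₀ x : N}
    (hx : x ∈ (chartAt H x₀).source) :
    coordMatrix I B x₀ (extChartAt I x₀ x)
      = LinearMap.BilinForm.toMatrix (chartBasis I hx) (B x).toBilinForm := by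
  ext A C
  rw [coordMatrix_apply_chart B hx, LinearMap.BilinForm.toMatrix_apply]
  rfl

theorem eq_of_coordMatrix_eq {B B' : BilinField I N} {x₀ x : N}
    (hx : x ∈ (chartAt H x₀).source)
    (h : coordMatrix I B x₀ (extChartAt I x₀ x) = coordMatrix I B' x₀ (extChartAt I x₀ x)) :
    B x = B' x := by
  rw [coordMatrix_eq_toMatrix B hx, coordMatrix_eq_toMatrix B' hx] at h
  have hform := (LinearMap.BilinForm.toMatrix (chartBasis I hx)).injective h
  ext u v
  exact congrArg (fun β : LinearMap.BilinForm ℝ (TangentSpace I x) => β u v) hform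

theorem exists_coordMatrix_change {x₀ x : N} (hx : x ∈ (chartAt H x₀).source) :
    ∃ P : Matrix (Fin d) (Fin d) ℝ, IsUnit P ∧ ∀ B : BilinField I N,
      coordMatrix I B x (extChartAt I x x) = Pᵀ * coordMatrix I B x₀ (extChartAt I x₀ x) * P := by
  have hx' : x ∈ (chartAt H x).source := mem_chart_source H x
  refine ⟨(chartBasis I hx).toMatrix (chartBasis I hx'), ?_, fun B => ?_⟩
  · rw [Matrix.isUnit_iff_isUnit_det, ← Module.Basis.det_apply]
    exact Module.Basis.isUnit_det _ _
  · rw [coordMatrix_eq_toMatrix B hx, coordMatrix_eq_toMatrix B hx',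
      LinearMap.BilinForm.toMatrix_mul_basis_toMatrix]

theorem coordMatrix_posDef (G : RiemMetric I N) {x₀ : N} {y : EuclideanSpace ℝ (Fin d)}
    (hy : y ∈ (extChartAt I x₀).target) : (coordMatrix I G.inner x₀ y).PosDef := by
  rw [← (extChartAt I x₀).right_inv hy,
    coordMatrix_eq_toMatrix G.inner (extChartAt_symm_mem_source hy),
    ← LinearMap.BilinForm.posDef_toQuadraticMap_iff_matrix]
  · exact fun v hv => G.pos _ v hv
  · exact ⟨G.symm _⟩

theorem SmoothFamily.contMDiffOn_apply_localFrame {a b : EReal} {G : ℝ → BilinField I N}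
    (hG : SmoothFamily I a b G)
    (e : Trivialization (EuclideanSpace ℝ (Fin d))
      (TotalSpace.proj : TangentBundle I N → N)) [MemTrivializationAtlas e]
    (b' : Module.Basis (Fin d) ℝ (EuclideanSpace ℝ (Fin d))) (A C : Fin d) :
    ContMDiffOn (𝓘(ℝ, ℝ).prod I) 𝓘(ℝ, ℝ) ∞
      (fun p : ℝ × N => G p.1 p.2 (e.localFrame b' A p.2) (e.localFrame b' C p.2))
      (openInterval a b ×ˢ e.baseSet) := by
  have hframe (A : Fin d) :
      ContMDiffOn (𝓘(ℝ, ℝ).prod I) (I.prod 𝓘(ℝ, EuclideanSpace ℝ (Fin d))) ∞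
        (fun p : ℝ × N => TotalSpace.mk' (EuclideanSpace ℝ (Fin d))
          (E := (TangentSpace I : N → Type _)) p.2 (e.localFrame b' A p.2))
        (openInterval a b ×ˢ e.baseSet) :=
    (e.contMDiffOn_localFrame_baseSet (I := I) ∞ b' A).comp contMDiffOn_snd fun p hp => hp.2
  have happly := ContMDiffOn.clm_bundle_apply₂ (F₃ := ℝ) (E₃ := fun _ : N => ℝ)
    (hG.mono (prod_mono_right (subset_univ _))) (hframe A) (hframe C)
  exact fun p hp => (contMDiffWithinAt_totalSpace.1 (happly p hp)).2

theorem SmoothFamily.contDiffOn_coordMatrix {a b : EReal} {G : ℝ → BilinField I N}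
    (hG : SmoothFamily I a b G) (x₀ : N) :
    ContDiffOn ℝ ∞ (fun z : ℝ × EuclideanSpace ℝ (Fin d) => coordMatrix I (G z.1) x₀ z.2)
      (openInterval a b ×ˢ (extChartAt I x₀).target) := by
  refine contDiffOn_matrix_iff.2 fun A C => ?_
  let e := trivializationAt (EuclideanSpace ℝ (Fin d)) (TangentSpace I : N → Type _) x₀
  have hbase : e.baseSet = (chartAt H x₀).source := TangentBundle.trivializationAt_baseSet x₀
  have hchart : ContMDiffOn 𝓘(ℝ, ℝ × EuclideanSpace ℝ (Fin d)) (𝓘(ℝ, ℝ).prod I) ∞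
      (fun z : ℝ × EuclideanSpace ℝ (Fin d) => (z.1, (extChartAt I x₀).symm z.2))
      (openInterval a b ×ˢ (extChartAt I x₀).target) :=
    contDiff_fst.contMDiff.contMDiffOn.prodMk
      ((contMDiffOn_extChartAt_symm x₀).comp contDiff_snd.contMDiff.contMDiffOn fun z hz => hz.2)
  refine (contMDiffOn_iff_contDiffOn.1 ((hG.contMDiffOn_apply_localFrame e
    (EuclideanSpace.basisFun (Fin d) ℝ).toBasis A C).comp hchart fun z hz =>
      ⟨hz.1, hbase ▸ extChartAt_symm_mem_source hz.2⟩)).congr fun z hz => ?_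
  have hx := extChartAt_symm_mem_source hz.2
  have hcoord := coordMatrix_apply_chart (G z.1) hx A C
  rw [(extChartAt I x₀).right_inv hz.2] at hcoord
  rw [hcoord, Function.comp_apply, e.localFrame_apply_of_mem_baseSet _ (hbase ▸ hx),
    e.localFrame_apply_of_mem_baseSet _ (hbase ▸ hx)]
  rfl

theorem smoothFamily_const (G : RiemMetric I N) (a b : EReal) :
    SmoothFamily I a b (fun _ => G.inner) :=
  (G.contMDiff.comp contMDiff_snd).contMDiffOn

end Charts

/-! ### Intervals with ends in the extended reals -/

section Intervals

variable {a b : EReal}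

theorem isOpen_openInterval (a b : EReal) : IsOpen (openInterval a b) :=
  isOpen_Ioo.preimage continuous_coe_real_ereal

instance ordConnected_openInterval : OrdConnected (openInterval a b) :=
  ordConnected_Ioo.preimage_mono fun _ _ => EReal.coe_le_coe_iff.2

theorem eventually_mem_openInterval (c : EReal) : ∀ᶠ r in nearIn a b c, r ∈ openInterval a b :=
  (eventually_mem_nhdsWithin (a := c) (s := Ioo a b)).comap Real.toEReal

theorem eventually_lt_nearIn_left {t : ℝ} (ht : t ∈ openInterval a b) :
    ∀ᶠ r in nearIn a b a, r < t :=
  ((eventually_nhdsWithin_of_eventually_nhds (eventually_lt_nhds ht.1)).comap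
    Real.toEReal).mono fun _ hr => EReal.coe_lt_coe_iff.1 hr

theorem eventually_gt_nearIn_right {t : ℝ} (ht : t ∈ openInterval a b) :
    ∀ᶠ r in nearIn a b b, t < r :=
  ((eventually_nhdsWithin_of_eventually_nhds (eventually_gt_nhds ht.2)).comap
    Real.toEReal).mono fun _ hr => EReal.coe_lt_coe_iff.1 hr

theorem nearIn_neBot (hab : a < b) {c : EReal} (hc : c ∈ Icc a b) : (nearIn a b c).NeBot := by
  have hne : (𝓝[Ioo a b] c).NeBot :=
    mem_closure_iff_nhdsWithin_neBot.1 ((closure_Ioo hab.ne).symm ▸ hc)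
  refine comap_neBot fun s hs => ?_
  obtain ⟨z, hz, hz'⟩ := hne.nonempty_of_mem (inter_mem hs self_mem_nhdsWithin)
  refine ⟨z.toReal, ?_⟩
  rwa [EReal.coe_toReal (hz'.2.trans_le le_top).ne (bot_le.trans_lt hz'.1).ne']

instance nearIn_isCountablyGenerated (c : EReal) : (nearIn a b c).IsCountablyGenerated :=
  comap.isCountablyGenerated _ _

end Intervals

/-! ### Families of metrics -/

section MetricFamily

open scoped Matrix Matrix.Norms.Operator

variable {d : ℕ} {H : Type*} [TopologicalSpace H]
  {I : ModelWithCorners ℝ (EuclideanSpace ℝ (Fin d)) H}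
  {N : Type*} [TopologicalSpace N] [ChartedSpace H N]

variable (I) in
/-- The regularity needed for the curvature of `dr² + G(r)` on `J × N` to be continuous: in every
chart of `N`, the matrix of `G(r)` is `C²` jointly in `r ∈ J` and the coordinates, and positive
definite. -/
structure MetricFamily (J : Set ℝ) (G : ℝ → BilinField I N) : Prop where
  isOpen : IsOpen J
  contDiffOn : ∀ x₀ : N, ContDiffOn ℝ 2
    (fun z : ℝ × EuclideanSpace ℝ (Fin d) => coordMatrix I (G z.1) x₀ z.2)
    (J ×ˢ (extChartAt I x₀).target)
  posDef : ∀ x₀ : N, ∀ z ∈ J ×ˢ (extChartAt I x₀).target, (coordMatrix I (G z.1) x₀ z.2).PosDef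

variable (I) in
/-- The Weingarten map of the level sets of `dr² + G(r)` in the chart of `N` around `x₀`, as a
function of the coordinates `(r, x^A)`. -/
def shapeInChart (G : ℝ → BilinField I N) (x₀ : N) (z : ℝ × EuclideanSpace ℝ (Fin d)) :
    Matrix (Fin d) (Fin d) ℝ :=
  shape (fun s => coordMatrix I (G s) x₀ z.2) z.1

theorem continuousOn_of_charts {Y : Type*} [TopologicalSpace Y] {J : Set ℝ} {F : ℝ × N → Y}
    (f : N → ℝ × EuclideanSpace ℝ (Fin d) → Y)
    (hf : ∀ x₀, ContinuousOn (f x₀) (J ×ˢ (extChartAt I x₀).target))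
    (hF : ∀ x₀, ∀ r ∈ J, ∀ x ∈ (chartAt H x₀).source, F (r, x) = f x₀ (r, extChartAt I x₀ x)) :
    ContinuousOn F (J ×ˢ univ) := by
  rintro ⟨r, x₀⟩ ⟨hr, -⟩
  have hchart : ContinuousOn (fun p : ℝ × N => (p.1, extChartAt I x₀ p.2))
      (J ×ˢ (chartAt H x₀).source) :=
    continuousOn_fst.prodMk ((continuousOn_extChartAt x₀).comp continuousOn_snd fun p hp =>
      (extChartAt_source I x₀).symm ▸ hp.2)
  have hsource : ContinuousOn F (J ×ˢ (chartAt H x₀).source) :=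
    ((hf x₀).comp hchart fun p hp => ⟨hp.1, extChartAt_mem_target hp.2⟩).congr
      fun p hp => hF x₀ p.1 hp.1 p.2 hp.2
  refine (hsource (r, x₀) ⟨hr, mem_chart_source H x₀⟩).mono_of_mem_nhdsWithin ?_
  rw [nhdsWithin_prod_eq]
  exact prod_mem_prod self_mem_nhdsWithin
    (mem_nhdsWithin_of_mem_nhds ((chartAt H x₀).open_source.mem_nhds (mem_chart_source H x₀)))

variable {J : Set ℝ} {G G' : ℝ → BilinField I N} {h : ℝ → ℝ}

theorem metricFamily_of_smoothFamily [IsManifold I ∞ N] {a b : EReal} {G : ℝ → RiemMetric I N}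
    (hG : SmoothFamily I a b (fun r => (G r).inner)) :
    MetricFamily I (openInterval a b) (fun r => (G r).inner) where
  isOpen := isOpen_openInterval a b
  contDiffOn x₀ := (hG.contDiffOn_coordMatrix x₀).of_le ENat.LEInfty.out
  posDef _ _ hz := coordMatrix_posDef _ hz.2

theorem MetricFamily.warped {B : BilinField I N} (hB : MetricFamily I J fun _ => B)
    (hh : ContDiffOn ℝ 2 h J) (h0 : ∀ r ∈ J, h r ≠ 0) : MetricFamily I J (warped I h B) where
  isOpen := hB.isOpen
  contDiffOn x₀ := ((hh.comp contDiffOn_fst fun _ hz => hz.1).pow 2).smul (hB.contDiffOn x₀)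
  posDef x₀ z hz := (hB.posDef x₀ z hz).smul (sq_pos_of_ne_zero (h0 z.1 hz.1))

namespace MetricFamily

variable (hG : MetricFamily I J G)

include hG

section Chart

variable {r : ℝ} (hr : r ∈ J) (x₀ : N) {y : EuclideanSpace ℝ (Fin d)}
  (hy : y ∈ (extChartAt I x₀).target)

include hr hy

theorem differentiableAt_coordMatrix :
    DifferentiableAt ℝ (fun s => coordMatrix I (G s) x₀ y) r :=
  differentiableAt_slice hG.isOpen ((hG.contDiffOn x₀).differentiableOn two_ne_zero) hr hy

theorem eventually_posDef : ∀ᶠ s in 𝓝 r, (coordMatrix I (G s) x₀ y).PosDef := by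
  filter_upwards [hG.isOpen.mem_nhds hr] with s hs using hG.posDef x₀ (s, y) ⟨hs, hy⟩

end Chart

theorem isUnit (x₀ : N) : ∀ z ∈ J ×ˢ (extChartAt I x₀).target,
    IsUnit (coordMatrix I (G z.1) x₀ z.2) :=
  fun z hz => (hG.posDef x₀ z hz).isUnit

theorem isSymm (x₀ : N) : ∀ z ∈ J ×ˢ (extChartAt I x₀).target,
    (coordMatrix I (G z.1) x₀ z.2).IsSymm :=
  fun z hz => Matrix.isHermitian_iff_isSymm.1 (hG.posDef x₀ z hz).isHermitian

theorem contDiffOn_shapeInChart (x₀ : N) :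
    ContDiffOn ℝ 1 (shapeInChart I G x₀) (J ×ˢ (extChartAt I x₀).target) :=
  contDiffOn_shape (γ := fun z => coordMatrix I (G z.1) x₀ z.2) hG.isOpen
    (uniqueDiffOn_extChartAt_target x₀) (hG.contDiffOn x₀) (hG.isUnit x₀) one_add_one_eq_two.le

theorem contDiffOn_trace_shapeInChart (x₀ : N) :
    ContDiffOn ℝ 1 (fun z => (shapeInChart I G x₀ z).trace) (J ×ˢ (extChartAt I x₀).target) :=
  contDiffOn_matrix_trace (hG.contDiffOn_shapeInChart x₀)

variable {r : ℝ} (hr : r ∈ J)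

include hr

theorem weingarten_eq_shapeInChart (x : N) :
    weingarten I G r x = shapeInChart I G x (r, extChartAt I x x) := by
  have hz : (r, extChartAt I x x) ∈ J ×ˢ (extChartAt I x).target :=
    ⟨hr, mem_extChartAt_target x⟩
  ext B A
  exact (christoffel_radial_comm (γ := fun z => coordMatrix I (G z.1) x z.2)
    (hG.isUnit x _ hz) B A).trans (christoffel_inr_radial_eq_shape hG.isOpen (hG.isUnit x)
      (hG.isSymm x) ((hG.contDiffOn x).differentiableOn two_ne_zero) hr hz.2 B A)

variable [IsManifold I ∞ N]

theorem exists_weingarten_eq_conj {x₀ x : N} (hx : x ∈ (chartAt H x₀).source) :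
    ∃ P : Matrix (Fin d) (Fin d) ℝ, IsUnit P ∧
      weingarten I G r x = P⁻¹ * shapeInChart I G x₀ (r, extChartAt I x₀ x) * P := by
  obtain ⟨P, hP, hchange⟩ := exists_coordMatrix_change (I := I) hx
  refine ⟨P, hP, ?_⟩
  rw [hG.weingarten_eq_shapeInChart hr, shapeInChart, funext fun s => hchange (G s),
    shape_conj (hG.differentiableAt_coordMatrix hr x₀ (extChartAt_mem_target hx)) hP, shapeInChart]

theorem meanCurvature_eq_trace {x₀ x : N} (hx : x ∈ (chartAt H x₀).source) :
    meanCurvature I G r x = (shapeInChart I G x₀ (r, extChartAt I x₀ x)).trace := by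
  obtain ⟨P, hP, hconj⟩ := hG.exists_weingarten_eq_conj hr hx
  rw [meanCurvature, hconj, Matrix.trace_conj' hP]

theorem trace_weingarten_sq_eq {x₀ x : N} (hx : x ∈ (chartAt H x₀).source) :
    (weingarten I G r x * weingarten I G r x).trace
      = (shapeInChart I G x₀ (r, extChartAt I x₀ x)
          * shapeInChart I G x₀ (r, extChartAt I x₀ x)).trace := by
  obtain ⟨P, hP, hconj⟩ := hG.exists_weingarten_eq_conj hr hx
  have hcancel : P * P⁻¹ = 1 := Matrix.mul_nonsing_inv P ((Matrix.isUnit_iff_isUnit_det P).1 hP)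
  rw [hconj, ← Matrix.trace_conj' hP (shapeInChart I G x₀ (r, extChartAt I x₀ x) * _)]
  simp only [Matrix.mul_assoc, ← Matrix.mul_assoc P, hcancel, Matrix.one_mul]

theorem meanCurvature_eventuallyEq {x₀ x : N} (hx : x ∈ (chartAt H x₀).source) :
    (fun s => meanCurvature I G s x) =ᶠ[𝓝 r]
      fun s => (shapeInChart I G x₀ (s, extChartAt I x₀ x)).trace := by
  filter_upwards [hG.isOpen.mem_nhds hr] with s hs using hG.meanCurvature_eq_trace hs hx

theorem differentiableAt_meanCurvature (x : N) :
    DifferentiableAt ℝ (fun s => meanCurvature I G s x) r :=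
  (differentiableAt_slice hG.isOpen ((hG.contDiffOn_trace_shapeInChart x).differentiableOn
    one_ne_zero) hr (mem_extChartAt_target x)).congr_of_eventuallyEq
    (hG.meanCurvature_eventuallyEq hr (mem_chart_source H x))

theorem ricciRR_eq_riccati (x : N) :
    ricciRR I G r x = - deriv (fun s => meanCurvature I G s x) r
      - (weingarten I G r x * weingarten I G r x).trace := by
  rw [(hG.meanCurvature_eventuallyEq hr (mem_chart_source H x)).deriv_eq,
    hG.weingarten_eq_shapeInChart hr]
  exact ricci_radial_eq_riccati (γ := fun z => coordMatrix I (G z.1) x z.2) hG.isOpen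
    (hG.isUnit x) (hG.isSymm x) (uniqueDiffOn_extChartAt_target x) (hG.contDiffOn x) hr
    (mem_extChartAt_target x)

theorem meanCurvature_congr (hG' : MetricFamily I J G') {x : N} (heq : ∀ s ∈ J, G s x = G' s x) :
    meanCurvature I G r x = meanCurvature I G' r x := by
  have hx : x ∈ (chartAt H x).source := mem_chart_source H x
  rw [hG.meanCurvature_eq_trace hr hx, hG'.meanCurvature_eq_trace hr hx, shapeInChart,
    shapeInChart]
  congr 1
  refine shape_congr ?_
  filter_upwards [hG.isOpen.mem_nhds hr] with s hs
  rw [coordMatrix_eq_toMatrix _ hx, coordMatrix_eq_toMatrix _ hx, heq s hs]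

omit hr

theorem continuousOn_meanCurvature :
    ContinuousOn (fun p : ℝ × N => meanCurvature I G p.1 p.2) (J ×ˢ univ) :=
  continuousOn_of_charts _ (fun x₀ => (hG.contDiffOn_trace_shapeInChart x₀).continuousOn)
    fun _ _ hr _ hx => hG.meanCurvature_eq_trace hr hx

theorem continuousOn_deriv_meanCurvature :
    ContinuousOn (fun p : ℝ × N => deriv (fun s => meanCurvature I G s p.2) p.1) (J ×ˢ univ) :=
  continuousOn_of_charts _ (fun x₀ => (contDiffOn_deriv_slice (m := 0) hG.isOpen
    (uniqueDiffOn_extChartAt_target x₀) (hG.contDiffOn_trace_shapeInChart x₀)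
    (zero_add 1).le).continuousOn)
    fun _ _ hr _ hx => (hG.meanCurvature_eventuallyEq hr hx).deriv_eq

theorem continuousOn_trace_weingarten_sq :
    ContinuousOn (fun p : ℝ × N => (weingarten I G p.1 p.2 * weingarten I G p.1 p.2).trace)
      (J ×ˢ univ) :=
  continuousOn_of_charts _ (fun x₀ => (contDiffOn_matrix_trace
    ((hG.contDiffOn_shapeInChart x₀).mul (hG.contDiffOn_shapeInChart x₀))).continuousOn)
    fun _ _ hr _ hx => hG.trace_weingarten_sq_eq hr hx

theorem continuousOn_ricciRR :
    ContinuousOn (fun p : ℝ × N => ricciRR I G p.1 p.2) (J ×ˢ univ) :=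
  (hG.continuousOn_deriv_meanCurvature.neg.sub hG.continuousOn_trace_weingarten_sq).congr
    fun p hp => hG.ricciRR_eq_riccati hp.1 p.2

end MetricFamily

end MetricFamily

/-! ### Evolution of the radial mass -/

section Mass

open scoped Matrix Matrix.Norms.Operator

variable {d : ℕ} {H : Type*} [TopologicalSpace H]
  {I : ModelWithCorners ℝ (EuclideanSpace ℝ (Fin d)) H}
  {N : Type*} [TopologicalSpace N] [ChartedSpace H N]
  {J : Set ℝ} {h : ℝ → ℝ} {B : BilinField I N} {G : ℝ → BilinField I N}

theorem eq_smul_of_deriv_eq_smul {E : Type*} [NormedAddCommGroup E] [NormedSpace ℝ E]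
    {γ : ℝ → E} (hJ : IsOpen J) (hJc : IsPreconnected J)
    (hγ : DifferentiableOn ℝ γ J) (hh : DifferentiableOn ℝ h J) (h0 : ∀ r ∈ J, h r ≠ 0)
    (hderiv : ∀ r ∈ J, deriv γ r = (2 * (deriv h r / h r)) • γ r) {r s : ℝ} (hr : r ∈ J)
    (hs : s ∈ J) : γ r = (h r ^ 2 * (h s ^ 2)⁻¹) • γ s := by
  have hquot (t) (ht : t ∈ J) : HasDerivAt (fun u => (h u ^ 2)⁻¹ • γ u) 0 t := by
    have ht0 : h t ≠ 0 := h0 t ht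
    have hht : HasDerivAt h (deriv h t) t :=
      ((hh t ht).differentiableAt (hJ.mem_nhds ht)).hasDerivAt
    have hγt : HasDerivAt γ ((2 * (deriv h t / h t)) • γ t) t :=
      hderiv t ht ▸ ((hγ t ht).differentiableAt (hJ.mem_nhds ht)).hasDerivAt
    refine (((hht.fun_pow 2).fun_inv (pow_ne_zero 2 ht0)).smul hγt).congr_deriv ?_
    rw [smul_smul, ← add_smul]
    convert zero_smul ℝ (γ t)
    field_simp
    ring
  have hconst : (h r ^ 2)⁻¹ • γ r = (h s ^ 2)⁻¹ • γ s :=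
    hJ.is_const_of_deriv_eq_zero hJc
      (fun t ht => (hquot t ht).differentiableAt.differentiableWithinAt)
      (fun t ht => (hquot t ht).deriv) hr hs
  rw [mul_smul, ← hconst, smul_inv_smul₀ (pow_ne_zero 2 (h0 r hr))]

variable (I) in
/-- The quantity `h² tr((S - S̊)²)`, where `S` and `S̊ = (h' / h) · 1` are the Weingarten maps of
the level sets for `dr² + G(r)` and for the warped product metric. -/
def weingartenDefect (h : ℝ → ℝ) (G : ℝ → BilinField I N) (p : ℝ × N) : ℝ :=
  h p.1 ^ 2 * ((weingarten I G p.1 p.2 - (deriv h p.1 / h p.1) • 1) *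
    (weingarten I G p.1 p.2 - (deriv h p.1 / h p.1) • 1)).trace

theorem MetricFamily.weingartenDefect_nonneg (hG : MetricFamily I J G) {r : ℝ} (hr : r ∈ J)
    (x : N) : 0 ≤ weingartenDefect I h G (r, x) := by
  have hy := mem_extChartAt_target (I := I) x
  rw [weingartenDefect, hG.weingarten_eq_shapeInChart hr]
  exact mul_nonneg (sq_nonneg _) (trace_shape_sub_sq_nonneg
    (hG.differentiableAt_coordMatrix hr x hy) (hG.eventually_posDef hr x hy) _)

theorem MetricFamily.deriv_coordMatrix_of_weingartenDefect_eq_zero (hG : MetricFamily I J G)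
    {r : ℝ} (hr : r ∈ J) (h0 : h r ≠ 0) {x : N} (hzero : weingartenDefect I h G (r, x) = 0) :
    deriv (fun s => coordMatrix I (G s) x (extChartAt I x x)) r
      = (2 * (deriv h r / h r)) • coordMatrix I (G r) x (extChartAt I x x) := by
  have hy := mem_extChartAt_target (I := I) x
  rw [weingartenDefect, hG.weingarten_eq_shapeInChart hr] at hzero
  exact (trace_shape_sub_sq_eq_zero_iff (hG.differentiableAt_coordMatrix hr x hy)
    (hG.eventually_posDef hr x hy) _).1
    ((mul_eq_zero.1 hzero).resolve_left (pow_ne_zero 2 h0))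

theorem MetricFamily.continuousOn_weingartenDefect [IsManifold I ∞ N] (hG : MetricFamily I J G)
    (hh : ContDiffOn ℝ 1 h J) (h0 : ∀ r ∈ J, h r ≠ 0) :
    ContinuousOn (weingartenDefect I h G) (J ×ˢ univ) := by
  have hfst : MapsTo (Prod.fst : ℝ × N → ℝ) (J ×ˢ univ) J := fun p hp => hp.1
  have hh₀ : ContinuousOn (fun p : ℝ × N => h p.1) (J ×ˢ univ) :=
    hh.continuousOn.comp continuousOn_fst hfst
  have hh₁ : ContinuousOn (fun p : ℝ × N => deriv h p.1 / h p.1) (J ×ˢ univ) :=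
    ((hh.continuousOn_deriv_of_isOpen hG.isOpen le_rfl).comp continuousOn_fst hfst).div hh₀
      fun p hp => h0 p.1 hp.1
  have hexpand : weingartenDefect I h G = fun p : ℝ × N => h p.1 ^ 2 *
      ((weingarten I G p.1 p.2 * weingarten I G p.1 p.2).trace
        - 2 * (deriv h p.1 / h p.1) * meanCurvature I G p.1 p.2
        + (deriv h p.1 / h p.1) ^ 2 * Fintype.card (Fin d)) :=
    funext fun p => congrArg (h p.1 ^ 2 * ·) (trace_sub_smul_one_sq _ _)
  rw [hexpand]
  exact (hh₀.pow 2).mul ((hG.continuousOn_trace_weingarten_sq.sub ((continuousOn_const.mul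
    hh₁).mul hG.continuousOn_meanCurvature)).add ((hh₁.pow 2).mul continuousOn_const))

theorem MetricFamily.eq_smul_of_weingartenDefect_eq_zero [IsManifold I ∞ N]
    (hG : MetricFamily I J G) (hJ : IsPreconnected J) (hh : DifferentiableOn ℝ h J)
    (h0 : ∀ r ∈ J, h r ≠ 0) {x : N} (hzero : ∀ r ∈ J, weingartenDefect I h G (r, x) = 0)
    {r s : ℝ} (hr : r ∈ J) (hs : s ∈ J) :
    G r x = (h r ^ 2 * (h s ^ 2)⁻¹) • G s x := by
  refine eq_of_coordMatrix_eq (B' := fun x => (h r ^ 2 * (h s ^ 2)⁻¹) • G s x)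
    (mem_chart_source H x) ?_
  exact eq_smul_of_deriv_eq_smul
    (γ := fun t => coordMatrix I (G t) x (extChartAt I x x)) hG.isOpen hJ
    (fun t ht => (hG.differentiableAt_coordMatrix ht x
      (mem_extChartAt_target x)).differentiableWithinAt) hh h0
    (fun t ht => hG.deriv_coordMatrix_of_weingartenDefect_eq_zero ht (h0 t ht) (hzero t ht)) hr hs

section Warped

variable (hB : MetricFamily I J fun _ => B) (hh : ContDiffOn ℝ 2 h J) (h0 : ∀ r ∈ J, h r ≠ 0)

include hB hh h0

theorem weingarten_warped {r : ℝ} (hr : r ∈ J) (x : N) :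
    weingarten I (warped I h B) r x = (deriv h r / h r) • 1 := by
  rw [(hB.warped hh h0).weingarten_eq_shapeInChart hr]
  exact shape_sq_smul_const
    ((hh.differentiableOn two_ne_zero r hr).differentiableAt (hB.isOpen.mem_nhds hr)) (h0 r hr)
    (hB.isUnit x (r, _) ⟨hr, mem_extChartAt_target x⟩)

variable [IsManifold I ∞ N] (hG : MetricFamily I J G)

include hG

theorem hasDerivAt_mass {r : ℝ} (hr : r ∈ J) (x : N) :
    HasDerivAt (fun s => mass I h B G s x)
      (ricciDefect I h B G (r, x) + weingartenDefect I h G (r, x)) r := by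
  have hB' := hB.warped hh h0
  have hdh : DifferentiableAt ℝ h r :=
    (hh.differentiableOn two_ne_zero r hr).differentiableAt (hB.isOpen.mem_nhds hr)
  refine ((hdh.hasDerivAt.fun_pow 2).mul ((hB'.differentiableAt_meanCurvature hr x).hasDerivAt.sub
    (hG.differentiableAt_meanCurvature hr x).hasDerivAt)).congr_deriv ?_
  have hne : h r ≠ 0 := h0 r hr
  have htrace : (weingarten I (warped I h B) r x).trace = d * (deriv h r / h r) := by
    simp [weingarten_warped hB hh h0 hr, mul_comm]
  have htrace_sq : (weingarten I (warped I h B) r x * weingarten I (warped I h B) r x).trace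
      = d * (deriv h r / h r) ^ 2 := by
    simp [weingarten_warped hB hh h0 hr]
    ring
  simp only [ricciDefect, weingartenDefect, hB'.ricciRR_eq_riccati hr, hG.ricciRR_eq_riccati hr,
    trace_sub_smul_one_sq, Pi.sub_apply, meanCurvature, htrace, htrace_sq, Fintype.card_fin]
  field_simp
  push_cast
  ring

theorem continuousOn_mass :
    ContinuousOn (fun p : ℝ × N => mass I h B G p.1 p.2) (J ×ˢ univ) :=
  ((hh.continuousOn.comp continuousOn_fst fun _ hp => hp.1).pow 2).mul
    ((hB.warped hh h0).continuousOn_meanCurvature.sub hG.continuousOn_meanCurvature)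

theorem continuousOn_ricciDefect : ContinuousOn (ricciDefect I h B G) (J ×ˢ univ) :=
  ((hh.continuousOn.comp continuousOn_fst fun _ hp => hp.1).pow 2).mul
    (hG.continuousOn_ricciRR.sub (hB.warped hh h0).continuousOn_ricciRR)

end Warped

end Mass

/-! ### The Riemannian volume of a compact manifold -/

section Volume

open scoped Matrix.Norms.Operator

variable {d : ℕ} {H : Type*} [TopologicalSpace H]
  {I : ModelWithCorners ℝ (EuclideanSpace ℝ (Fin d)) H}
  {N : Type*} [TopologicalSpace N]

theorem measure_inter_range_pos (I : ModelWithCorners ℝ (EuclideanSpace ℝ (Fin d)) H)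
    (μ : Measure (EuclideanSpace ℝ (Fin d))) [μ.IsOpenPosMeasure]
    {O : Set (EuclideanSpace ℝ (Fin d))} (hO : IsOpen O) (hne : (O ∩ range I).Nonempty) :
    0 < μ (O ∩ range I) := by
  obtain ⟨y, hyO, hyI⟩ := hne
  have hmeet : (O ∩ interior (range I)).Nonempty :=
    mem_closure_iff.1 (I.range_subset_closure_interior hyI) O hO hyO
  exact ((hO.inter isOpen_interior).measure_pos μ hmeet).trans_le
    (measure_mono (inter_subset_inter_right O interior_subset))

variable [ChartedSpace H N]

theorem exists_isOpen_preimage_extChartAt_symm_eq (c : N) {U : Set N} (hU : IsOpen U) :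
    ∃ O, IsOpen O ∧ (extChartAt I c).symm ⁻¹' U ∩ (extChartAt I c).target = O ∩ range I := by
  obtain ⟨O, hO, hOU⟩ := continuousOn_iff'.1 (continuousOn_extChartAt_symm (I := I) c) U hU
  refine ⟨O ∩ I.symm ⁻¹' (chartAt H c).target,
    hO.inter ((chartAt H c).open_target.preimage I.continuous_symm), ?_⟩
  rw [hOU, extChartAt_target, inter_assoc]

theorem volume_preimage_extChartAt_symm_pos {c : N} {U : Set N} (hU : IsOpen U)
    (hUs : U ⊆ (chartAt H c).source) (hne : U.Nonempty) :
    0 < volume ((extChartAt I c).symm ⁻¹' U ∩ (extChartAt I c).target) := by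
  obtain ⟨O, hO, hOU⟩ := exists_isOpen_preimage_extChartAt_symm_eq (I := I) c hU
  obtain ⟨x, hx⟩ := hne
  rw [hOU]
  refine measure_inter_range_pos I volume hO ⟨extChartAt I c x, hOU ▸ ⟨?_, ?_⟩⟩
  · rwa [mem_preimage,
      (extChartAt I c).left_inv ((extChartAt_source I c).symm ▸ hUs hx)]
  · exact extChartAt_mem_target (hUs hx)

theorem measurableSet_extChartAt_target (c : N) : MeasurableSet (extChartAt I c).target := by
  rw [extChartAt_target]
  exact (((chartAt H c).open_target.preimage I.continuous_symm).measurableSet).inter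
    I.isClosed_range.measurableSet

theorem chartVolume_apply [MeasurableSpace N] [BorelSpace N] (B : BilinField I N) (ρ : N → ℝ)
    (c : N) {s : Set N} (hs : MeasurableSet s) :
    chartVolume I B ρ c s = ((volume.restrict (extChartAt I c).target).withDensity fun y =>
      ENNReal.ofReal (ρ ((extChartAt I c).symm y) * √(coordMatrix I B c y).det))
        ((extChartAt I c).symm ⁻¹' s) :=
  Measure.map_apply_of_aemeasurable (((continuousOn_extChartAt_symm c).aemeasurable
    (measurableSet_extChartAt_target c)).mono_ac (withDensity_absolutelyContinuous _ _)) hs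

variable [IsManifold I ∞ N]

theorem continuousOn_coordMatrix (G : RiemMetric I N) (c : N) :
    ContinuousOn (coordMatrix I G.inner c) (extChartAt I c).target :=
  ((smoothFamily_const G ⊥ ⊤).contDiffOn_coordMatrix c).continuousOn.comp
    (f := fun y => ((0 : ℝ), y)) (continuousOn_const.prodMk continuousOn_id)
    fun _ hy => ⟨⟨EReal.bot_lt_coe 0, EReal.coe_lt_top 0⟩, hy⟩

theorem continuousOn_chartDensity (G : RiemMetric I N) {ρ : N → ℝ} (hρ : Continuous ρ) (c : N) :
    ContinuousOn (fun y => ρ ((extChartAt I c).symm y) * √(coordMatrix I G.inner c y).det)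
      (extChartAt I c).target :=
  (hρ.comp_continuousOn (continuousOn_extChartAt_symm c)).mul
    ((Real.continuous_sqrt.comp continuous_id.matrix_det).comp_continuousOn
      (continuousOn_coordMatrix G c))

theorem integrableOn_chartDensity (G : RiemMetric I N) {ρ : N → ℝ} (hρ : Continuous ρ)
    (hρK : HasCompactSupport ρ) {c : N} (hc : tsupport ρ ⊆ (chartAt H c).source) :
    IntegrableOn (fun y => ρ ((extChartAt I c).symm y) * √(coordMatrix I G.inner c y).det)
      (extChartAt I c).target := by
  have hK : IsCompact (extChartAt I c '' tsupport ρ) := hρK.isCompact.image_of_continuousOn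
    ((continuousOn_extChartAt c).mono ((extChartAt_source I c).symm ▸ hc))
  have hKT : extChartAt I c '' tsupport ρ ⊆ (extChartAt I c).target :=
    image_subset_iff.2 fun x hx => extChartAt_mem_target (hc hx)
  refine (((continuousOn_chartDensity G hρ c).mono hKT).integrableOn_compact
    hK).of_forall_sdiff_eq_zero (measurableSet_extChartAt_target c) fun y hy => ?_
  have hzero : ρ ((extChartAt I c).symm y) = 0 := by
    by_contra hne
    exact hy.2 ⟨_, subset_tsupport ρ hne, (extChartAt I c).right_inv hy.1⟩
  rw [hzero, zero_mul]

variable [MeasurableSpace N]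

theorem isFiniteMeasure_chartVolume (G : RiemMetric I N) {ρ : N → ℝ} (hρ : Continuous ρ)
    (hρK : HasCompactSupport ρ) {c : N} (hc : tsupport ρ ⊆ (chartAt H c).source) :
    IsFiniteMeasure (chartVolume I G.inner ρ c) := by
  have := isFiniteMeasure_withDensity_ofReal (integrableOn_chartDensity G hρ hρK hc).2
  exact Measure.isFiniteMeasure_map _ _

theorem chartVolume_pos [BorelSpace N] (G : RiemMetric I N) {ρ : N → ℝ} {c : N} {U : Set N}
    (hU : IsOpen U) (hρ : ∀ x ∈ U, 0 < ρ x) (hρc : Continuous ρ)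
    (hUs : U ⊆ (chartAt H c).source) (hne : U.Nonempty) :
    0 < chartVolume I G.inner ρ c U := by
  have hT := measurableSet_extChartAt_target (I := I) c
  rw [pos_iff_ne_zero, chartVolume_apply _ _ _ hU.measurableSet, Ne, withDensity_apply_eq_zero'
    ((continuousOn_chartDensity G hρc c).aemeasurable hT).ennreal_ofReal,
    Measure.restrict_apply' hT]
  refine ((volume_preimage_extChartAt_symm_pos (I := I) hU hUs hne).trans_le
    (measure_mono ?_)).ne'
  intro y hy
  refine ⟨⟨?_, hy.1⟩, hy.2⟩
  exact (ENNReal.ofReal_pos.2 (mul_pos (hρ _ hy.1)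
    (Real.sqrt_pos.2 (coordMatrix_posDef G hy.2).det_pos))).ne'

section Partition

variable [T2Space N]

omit [MeasurableSpace N] in
theorem chartPartition_isSubordinate [SigmaCompactSpace N] :
    (chartPartition I N).IsSubordinate (fun x => (chartAt H x).source) :=
  Classical.choose_spec (SmoothPartitionOfUnity.exists_isSubordinate_chartAt_source I N)

theorem isFiniteMeasure_riemannianVolume [CompactSpace N] (G : RiemMetric I N) :
    IsFiniteMeasure (riemannianVolume I G) := by
  have hfin : {c : N | (Function.support (chartPartition I N c)).Nonempty}.Finite :=
    (chartPartition I N).locallyFinite.finite_nonempty_of_compact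
  have hzero (c : N) (hc : c ∉ hfin.toFinset) :
      chartVolume I G.inner (chartPartition I N c) c univ = 0 := by
    have hc' : ∀ x, chartPartition I N c x = 0 := by simpa [Set.Nonempty] using hc
    simp [chartVolume, hc']
  refine ⟨?_⟩
  rw [riemannianVolume, Measure.sum_apply _ MeasurableSet.univ, tsum_eq_sum hzero]
  refine ENNReal.sum_lt_top.2 fun c _ => ?_
  have := isFiniteMeasure_chartVolume G (chartPartition I N c).contMDiff.continuous
    (.of_compactSpace _) (chartPartition_isSubordinate (I := I) c)
  exact measure_lt_top _ _

theorem isOpenPosMeasure_riemannianVolume [SigmaCompactSpace N] [BorelSpace N]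
    (G : RiemMetric I N) : (riemannianVolume I G).IsOpenPosMeasure := by
  refine ⟨fun U hU ⟨x, hx⟩ => ?_⟩
  obtain ⟨c, hc⟩ := (chartPartition I N).exists_pos_of_mem (mem_univ x)
  have hcont : Continuous (chartPartition I N c) := (chartPartition I N c).contMDiff.continuous
  have hpos : 0 < chartVolume I G.inner (chartPartition I N c) c
      (U ∩ {x | 0 < chartPartition I N c x}) :=
    chartVolume_pos G (hU.inter (isOpen_lt continuous_const hcont)) (fun x hx => hx.2) hcont
      (fun x hx => chartPartition_isSubordinate (I := I) c (subset_tsupport _ hx.2.ne'))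
      ⟨x, hx, hc⟩
  refine ((hpos.trans_le (measure_mono inter_subset_left)).trans_le ?_).ne'
  exact Measure.le_sum (fun c : N => chartVolume I G.inner (chartPartition I N c) c) c U

end Partition

end Volume

/-! ### Integrating an evolution equation over `(a, b) × N` -/

section Evolution

theorem integrable_of_eventually_integrableOn_of_integral_tendsto {α ι : Type*}
    [MeasurableSpace α] {ν : Measure α} {l : Filter ι} [l.NeBot] [l.IsCountablyGenerated]
    {φ : ι → Set α} {f : α → ℝ} {c : ℝ} (hφ : AECover ν l φ)
    (hfi : ∀ᶠ i in l, IntegrableOn f (φ i) ν) (hf : ∀ᵐ x ∂ν, 0 ≤ f x)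
    (hc : Tendsto (fun i => ∫ x in φ i, f x ∂ν) l (𝓝 c)) :
    Integrable f ν := by
  obtain ⟨i, hi, hint⟩ := exists_seq_forall_of_frequently hfi.frequently
  exact (hφ.comp_tendsto hi).integrable_of_integral_tendsto_of_nonneg_ae c hint hf (hc.comp hi)

theorem eqOn_zero_of_setIntegral_eq_zero {X : Type*} [TopologicalSpace X] [MeasurableSpace X]
    [OpensMeasurableSpace X] {ν : Measure X} [ν.IsOpenPosMeasure] {U : Set X} (hU : IsOpen U)
    {f : X → ℝ} (hf : ContinuousOn f U) (h0 : ∀ x ∈ U, 0 ≤ f x) (hfi : IntegrableOn f U ν)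
    (hzero : ∫ x in U, f x ∂ν = 0) : EqOn f 0 U :=
  Measure.eqOn_open_of_ae_eq ((integral_eq_zero_iff_of_nonneg_ae
    (ae_restrict_of_forall_mem hU.measurableSet h0) hfi).1 hzero) hU hf continuousOn_const

variable {N : Type*} [MeasurableSpace N] {μ : Measure N} {a b : EReal} {r s : ℝ}

theorem restrict_prod_eq_restrict_prod_univ [SFinite μ] (J : Set ℝ) :
    (volume.restrict J).prod μ = (volume.prod μ).restrict (J ×ˢ univ) := by
  rw [← Measure.prod_restrict, Measure.restrict_univ]

theorem ae_nonneg_of_forall_mem_openInterval [SFinite μ] {Q : ℝ × N → ℝ}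
    (hQ : ∀ r ∈ openInterval a b, ∀ x, 0 ≤ Q (r, x)) :
    ∀ᵐ p ∂((volume.restrict (openInterval a b)).prod μ), 0 ≤ Q p := by
  rw [restrict_prod_eq_restrict_prod_univ]
  exact ae_restrict_of_forall_mem ((isOpen_openInterval a b).measurableSet.prod .univ)
    fun p hp => hQ p.1 hp.1 p.2

theorem aecover_Ioc_prod_univ : AECover ((volume.restrict (openInterval a b)).prod μ)
    (nearIn a b a ×ˢ nearIn a b b) (fun i : ℝ × ℝ => Ioc i.1 i.2 ×ˢ (univ : Set N)) := by
  refine ⟨?_, fun i => measurableSet_Ioc.prod MeasurableSet.univ⟩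
  have hmem : ∀ᵐ p ∂((volume.restrict (openInterval a b)).prod μ), p.1 ∈ openInterval a b :=
    Measure.quasiMeasurePreserving_fst.ae
      (ae_restrict_mem (isOpen_openInterval a b).measurableSet)
  filter_upwards [hmem] with p hp
  filter_upwards [(eventually_lt_nearIn_left hp).prod_mk (eventually_gt_nearIn_right hp)]
    with i hi
  exact ⟨⟨hi.1, hi.2.le⟩, mem_univ _⟩

theorem restrict_Ioc_prod_univ [SFinite μ] (hr : r ∈ openInterval a b)
    (hs : s ∈ openInterval a b) :
    ((volume.restrict (openInterval a b)).prod μ).restrict (Ioc r s ×ˢ univ)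
      = (volume.restrict (Ioc r s)).prod μ := by
  rw [← Measure.prod_restrict, Measure.restrict_univ, Measure.restrict_restrict measurableSet_Ioc,
    inter_eq_self_of_subset_left (Ioc_subset_Icc_self.trans (OrdConnected.out' hr hs))]

variable [TopologicalSpace N] [OpensMeasurableSpace N]

theorem eqOn_zero_of_integral_eq_zero [SFinite μ] [μ.IsOpenPosMeasure] {Q : ℝ × N → ℝ}
    (hQ : ContinuousOn Q (openInterval a b ×ˢ univ))
    (hQ0 : ∀ r ∈ openInterval a b, ∀ x, 0 ≤ Q (r, x))
    (hQi : Integrable Q ((volume.restrict (openInterval a b)).prod μ))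
    (hzero : ∫ p, Q p ∂((volume.restrict (openInterval a b)).prod μ) = 0) :
    EqOn Q 0 (openInterval a b ×ˢ univ) := by
  rw [restrict_prod_eq_restrict_prod_univ] at hQi hzero
  exact eqOn_zero_of_setIntegral_eq_zero ((isOpen_openInterval a b).prod isOpen_univ) hQ
    (fun p hp => hQ0 p.1 hp.1 p.2) hQi hzero

variable [CompactSpace N] [IsFiniteMeasure μ]

theorem integrableOn_Ioc_prod_univ {F : ℝ × N → ℝ}
    (hF : ContinuousOn F (openInterval a b ×ˢ univ)) (hr : r ∈ openInterval a b)
    (hs : s ∈ openInterval a b) :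
    IntegrableOn F (Ioc r s ×ˢ univ) ((volume.restrict (openInterval a b)).prod μ) := by
  rw [IntegrableOn, restrict_Ioc_prod_univ hr hs, restrict_prod_eq_restrict_prod_univ]
  exact ((hF.mono (prod_mono_left (OrdConnected.out' hr hs))).integrableOn_compact'
    (isCompact_Icc.prod isCompact_univ) (measurableSet_Icc.prod .univ)).mono_set
      (prod_mono_left Ioc_subset_Icc_self)

variable {m : ℝ → N → ℝ}

theorem setIntegral_Ioc_prod_univ_of_hasDerivAt {F : ℝ × N → ℝ}
    (hF : ContinuousOn F (openInterval a b ×ˢ univ))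
    (hm : ∀ r ∈ openInterval a b, Continuous (m r))
    (hd : ∀ r ∈ openInterval a b, ∀ x, HasDerivAt (fun s => m s x) (F (r, x)) r)
    (hr : r ∈ openInterval a b) (hs : s ∈ openInterval a b) (hrs : r ≤ s) :
    ∫ p in Ioc r s ×ˢ univ, F p ∂((volume.restrict (openInterval a b)).prod μ)
      = (∫ x, m s x ∂μ) - ∫ x, m r x ∂μ := by
  have hmi (t) (ht : t ∈ openInterval a b) : Integrable (m t) μ :=
    integrableOn_univ.1 ((hm t ht).continuousOn.integrableOn_compact' isCompact_univ .univ)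
  have hFi := integrableOn_Ioc_prod_univ (μ := μ) hF hr hs
  have hsub : uIcc r s ⊆ openInterval a b := ordConnected_openInterval.uIcc_subset hr hs
  rw [IntegrableOn, restrict_Ioc_prod_univ hr hs] at hFi
  rw [restrict_Ioc_prod_univ hr hs, integral_prod_symm _ hFi, ← integral_sub (hmi s hs) (hmi r hr)]
  congr with x
  have hcont : ContinuousOn (fun t => F (t, x)) (uIcc r s) :=
    hF.comp (continuousOn_id.prodMk continuousOn_const) fun t ht => ⟨hsub ht, mem_univ _⟩
  rw [← intervalIntegral.integral_of_le hrs, intervalIntegral.integral_eq_sub_of_hasDerivAt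
    (fun t ht => hd t (hsub ht) x) hcont.intervalIntegrable]

variable {F Q : ℝ × N → ℝ} {mA mB : ℝ} (hab : a < b)
  (hF : ContinuousOn F (openInterval a b ×ˢ univ))
  (hQ : ContinuousOn Q (openInterval a b ×ˢ univ))
  (hm : ∀ r ∈ openInterval a b, Continuous (m r))
  (hd : ∀ r ∈ openInterval a b, ∀ x, HasDerivAt (fun s => m s x) (F (r, x) + Q (r, x)) r)
  (hA : Tendsto (fun r => ∫ x, m r x ∂μ) (nearIn a b a) (𝓝 mA))
  (hB : Tendsto (fun r => ∫ x, m r x ∂μ) (nearIn a b b) (𝓝 mB))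
  (hFi : Integrable F ((volume.restrict (openInterval a b)).prod μ))

include hab hF hQ hm hd hA hB hFi

theorem tendsto_setIntegral_Ioc_prod_univ :
    Tendsto (fun i : ℝ × ℝ =>
        ∫ p in Ioc i.1 i.2 ×ˢ univ, Q p ∂((volume.restrict (openInterval a b)).prod μ))
      (nearIn a b a ×ˢ nearIn a b b)
      (𝓝 (mB - mA - ∫ p, F p ∂((volume.restrict (openInterval a b)).prod μ))) := by
  have := nearIn_neBot hab (left_mem_Icc.2 hab.le)
  obtain ⟨t, ht⟩ := (eventually_mem_openInterval (a := a) (b := b) a).exists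
  refine (((hB.comp tendsto_snd).sub (hA.comp tendsto_fst)).sub
    (aecover_Ioc_prod_univ.integral_tendsto_of_countably_generated hFi)).congr' ?_
  filter_upwards [(eventually_mem_openInterval a).prod_mk (eventually_mem_openInterval b),
    (eventually_lt_nearIn_left ht).prod_mk (eventually_gt_nearIn_right ht)] with i ⟨hr, hs⟩ hlt
  have hftc := setIntegral_Ioc_prod_univ_of_hasDerivAt (μ := μ) (hF.add hQ) hm hd hr hs
    (hlt.1.trans hlt.2).le
  have hadd := integral_add (integrableOn_Ioc_prod_univ (μ := μ) hF hr hs)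
    (integrableOn_Ioc_prod_univ (μ := μ) hQ hr hs)
  simp only [Pi.add_apply] at hftc
  simp only [Function.comp_apply]
  rw [← hftc, hadd, add_sub_cancel_left]

theorem integrable_and_limit_sub_limit_eq
    (hQ0 : ∀ r ∈ openInterval a b, ∀ x, 0 ≤ Q (r, x)) :
    Integrable Q ((volume.restrict (openInterval a b)).prod μ) ∧
      mB - mA = ∫ p, F p ∂((volume.restrict (openInterval a b)).prod μ)
        + ∫ p, Q p ∂((volume.restrict (openInterval a b)).prod μ) := by
  have := nearIn_neBot hab (left_mem_Icc.2 hab.le)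
  have := nearIn_neBot hab (right_mem_Icc.2 hab.le)
  have hlim := tendsto_setIntegral_Ioc_prod_univ hab hF hQ hm hd hA hB hFi
  have hint : ∀ᶠ i : ℝ × ℝ in nearIn a b a ×ˢ nearIn a b b, IntegrableOn Q
      (Ioc i.1 i.2 ×ˢ univ) ((volume.restrict (openInterval a b)).prod μ) :=
    ((eventually_mem_openInterval a).prod_mk (eventually_mem_openInterval b)).mono
      fun _ hi => integrableOn_Ioc_prod_univ hQ hi.1 hi.2
  have hQi := integrable_of_eventually_integrableOn_of_integral_tendsto aecover_Ioc_prod_univ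
    hint (ae_nonneg_of_forall_mem_openInterval hQ0) hlim
  refine ⟨hQi, ?_⟩
  linarith [tendsto_nhds_unique hlim
    (aecover_Ioc_prod_univ.integral_tendsto_of_countably_generated hQi)]

end Evolution

/-! ### The limits of the radial mass -/

section Limits

variable {d : ℕ} {H : Type*} [TopologicalSpace H]
  {I : ModelWithCorners ℝ (EuclideanSpace ℝ (Fin d)) H}
  {N : Type*} [TopologicalSpace N] [ChartedSpace H N] [IsManifold I ∞ N]
  {a b : EReal} {h : ℝ → ℝ}

/-- The metric `c² G`. -/
def scaledMetric (G : RiemMetric I N) (c : ℝ) (hc : c ≠ 0) : RiemMetric I N where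
  inner x := c ^ 2 • G.inner x
  symm x v w := congrArg (c ^ 2 * ·) (G.symm x v w)
  pos x v hv := mul_pos (by positivity) (G.pos x v hv)
  isVonNBounded x := by
    have himage := (G.isVonNBounded x).image (c⁻¹ • ContinuousLinearMap.id ℝ (TangentSpace I x))
    refine himage.subset fun v hv => ?_
    refine ⟨c • v, ?_, inv_smul_smul₀ hc v⟩
    change G.inner x (c • v) (c • v) < 1
    have hv' : c ^ 2 * G.inner x v v < 1 := hv
    rw [map_smul, map_smul, smul_apply, smul_eq_mul, smul_eq_mul]
    linarith
  contMDiff := by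
    have (x : N) : ContinuousAdd (TangentSpace I x →L[ℝ] ℝ) :=
      inferInstanceAs (ContinuousAdd (EuclideanSpace ℝ (Fin d) →L[ℝ] ℝ))
    exact G.contMDiff.const_smul_section (a := c ^ 2)

theorem metricFamily_const (G : RiemMetric I N) (a b : EReal) :
    MetricFamily I (openInterval a b) fun _ => G.inner :=
  metricFamily_of_smoothFamily (G := fun _ => G) (smoothFamily_const G a b)

omit [IsManifold I ∞ N] in
theorem MetricFamily.integral_weingartenDefect_nonneg {G : ℝ → BilinField I N}
    (hG : MetricFamily I (openInterval a b) G) (h : ℝ → ℝ) [MeasurableSpace N] (μ : Measure N)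
    [SFinite μ] :
    0 ≤ ∫ p, weingartenDefect I h G p ∂((volume.restrict (openInterval a b)).prod μ) :=
  integral_nonneg_of_ae (ae_nonneg_of_forall_mem_openInterval fun _ hr x =>
    hG.weingartenDefect_nonneg hr x)

section Asymptotics

variable {c : EReal}

omit [IsManifold I ∞ N] in
theorem AsymptoticAt.congr_left {G G' G₀ : ℝ → BilinField I N} (hG : AsymptoticAt I a b c G G₀)
    (heq : ∀ r ∈ openInterval a b, ∀ x, G r x = G' r x) : AsymptoticAt I a b c G' G₀ := by
  intro ε hε
  filter_upwards [hG ε hε, eventually_mem_openInterval c] with r hr hrJ x u v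
  rw [← heq r hrJ x]
  exact hr x u v

omit [IsManifold I ∞ N] in
theorem abs_sub_le_of_asymptoticAt_warped (hab : a < b) (hc : c ∈ Icc a b)
    (h0 : ∀ r ∈ openInterval a b, h r ≠ 0) {B B' : BilinField I N}
    (has : AsymptoticAt I a b c (warped I h B') (warped I h B)) (x : N) (u v : TangentSpace I x)
    {ε : ℝ} (hε : 0 < ε) : |B' x u v - B x u v| ≤ ε * (√(B x u u) * √(B x v v)) := by
  have := nearIn_neBot hab hc
  obtain ⟨r, hr, hrJ⟩ := ((has ε hε).and (eventually_mem_openInterval c)).exists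
  have hpos : 0 < h r ^ 2 := sq_pos_of_ne_zero (h0 r hrJ)
  have hscaled : |h r ^ 2 * B' x u v - h r ^ 2 * B x u v|
      ≤ ε * √(h r ^ 2 * B x u u) * √(h r ^ 2 * B x v v) := hr x u v
  rw [← mul_sub, abs_mul, abs_of_pos hpos, Real.sqrt_mul hpos.le, Real.sqrt_mul hpos.le]
    at hscaled
  refine le_of_mul_le_mul_left (hscaled.trans_eq ?_) hpos
  linear_combination (ε * √(B x u u) * √(B x v v)) * Real.mul_self_sqrt hpos.le

omit [IsManifold I ∞ N] in
theorem eq_of_asymptoticAt_warped (hab : a < b) (hc : c ∈ Icc a b)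
    (h0 : ∀ r ∈ openInterval a b, h r ≠ 0) {B B' : BilinField I N}
    (has : AsymptoticAt I a b c (warped I h B') (warped I h B)) (x : N) : B' x = B x := by
  ext u v
  have hlim : Tendsto (fun ε : ℝ => ε * (√(B x u u) * √(B x v v))) (𝓝[>] 0) (𝓝 0) :=
    (Continuous.tendsto' (continuous_id.mul continuous_const) 0 0 (zero_mul _)).mono_left
      nhdsWithin_le_nhds
  exact sub_eq_zero.1 (abs_nonpos_iff.1 (ge_of_tendsto hlim (eventually_mem_nhdsWithin.mono
    fun ε hε => abs_sub_le_of_asymptoticAt_warped hab hc h0 has x u v hε)))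

end Asymptotics

variable (hh : ContDiffOn ℝ 2 h (openInterval a b)) (h0 : ∀ r ∈ openInterval a b, h r ≠ 0)
  {Ghat : RiemMetric I N} {G : ℝ → RiemMetric I N}
  (hG : MetricFamily I (openInterval a b) fun r => (G r).inner)

include hh h0 hG

theorem mass_eq_zero_of_eq_warped {Gtilde : RiemMetric I N} {x : N}
    (hw : ∀ r ∈ openInterval a b, (G r).inner x = warped I h Gtilde.inner r x) {r : ℝ}
    (hr : r ∈ openInterval a b) : mass I h Ghat.inner (fun r => (G r).inner) r x = 0 := by
  have htilde := metricFamily_const Gtilde a b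
  rw [mass, hG.meanCurvature_congr hr (htilde.warped hh h0) hw, meanCurvature, meanCurvature,
    weingarten_warped (metricFamily_const Ghat a b) hh h0 hr,
    weingarten_warped htilde hh h0 hr, sub_self, mul_zero]

theorem exists_eq_warped_of_weingartenDefect_eq_zero (hab : a < b)
    (hzero : EqOn (weingartenDefect I h fun r => (G r).inner) 0 (openInterval a b ×ˢ univ)) :
    ∃ Gtilde : RiemMetric I N, ∀ r ∈ openInterval a b, ∀ x,
      (G r).inner x = warped I h Gtilde.inner r x := by
  have := nearIn_neBot hab (left_mem_Icc.2 hab.le)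
  obtain ⟨s, hs⟩ := (eventually_mem_openInterval (a := a) (b := b) a).exists
  refine ⟨scaledMetric (G s) (h s)⁻¹ (inv_ne_zero (h0 s hs)), fun r hr x => ?_⟩
  rw [hG.eq_smul_of_weingartenDefect_eq_zero ordConnected_openInterval.isPreconnected
    (hh.differentiableOn two_ne_zero) h0 (fun t ht => hzero ⟨ht, mem_univ x⟩) hr hs, mul_smul,
    ← inv_pow]
  rfl

variable [T2Space N] [CompactSpace N] [MeasurableSpace N]

section

variable (hab : a < b) {massA massB : ℝ}
  (hA : Tendsto (totalMass I h Ghat fun r => (G r).inner) (nearIn a b a) (𝓝 massA))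
  (hB : Tendsto (totalMass I h Ghat fun r => (G r).inner) (nearIn a b b) (𝓝 massB))

include hab hA hB

theorem limits_eq_of_eq_warped {Gtilde : RiemMetric I N}
    (hw : ∀ r ∈ openInterval a b, ∀ x, (G r).inner x = warped I h Gtilde.inner r x) :
    massB = massA := by
  have := nearIn_neBot hab (left_mem_Icc.2 hab.le)
  have := nearIn_neBot hab (right_mem_Icc.2 hab.le)
  have hmass (r) (hr : r ∈ openInterval a b) :
      totalMass I h Ghat (fun r => (G r).inner) r = 0 :=
    integral_eq_zero_of_ae (ae_of_all _ fun x =>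
      mass_eq_zero_of_eq_warped hh h0 hG (fun r hr => hw r hr x) hr)
  have hlim (c : EReal) :
      Tendsto (totalMass I h Ghat fun r => (G r).inner) (nearIn a b c) (𝓝 0) :=
    tendsto_const_nhds.congr' ((eventually_mem_openInterval c).mono fun r hr => (hmass r hr).symm)
  rw [tendsto_nhds_unique hB (hlim b), tendsto_nhds_unique hA (hlim a)]

variable [BorelSpace N]
  (hint : Integrable (ricciDefect I h Ghat.inner fun r => (G r).inner)
    ((volume.restrict (openInterval a b)).prod (riemannianVolume I Ghat)))

include hint

theorem integrable_weingartenDefect_and_limit_sub_limit_eq :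
    Integrable (weingartenDefect I h fun r => (G r).inner)
        ((volume.restrict (openInterval a b)).prod (riemannianVolume I Ghat)) ∧
      massB - massA = ∫ p, ricciDefect I h Ghat.inner (fun r => (G r).inner) p
          ∂((volume.restrict (openInterval a b)).prod (riemannianVolume I Ghat))
        + ∫ p, weingartenDefect I h (fun r => (G r).inner) p
          ∂((volume.restrict (openInterval a b)).prod (riemannianVolume I Ghat)) := by
  have hGhat := metricFamily_const Ghat a b
  have := isFiniteMeasure_riemannianVolume Ghat
  exact integrable_and_limit_sub_limit_eq hab (continuousOn_ricciDefect hGhat hh h0 hG)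
    (hG.continuousOn_weingartenDefect (hh.of_le one_le_two) h0)
    (fun r hr => continuousOn_univ.1 ((continuousOn_mass hGhat hh h0 hG).comp
      (continuousOn_const.prodMk continuousOn_id) fun x hx => ⟨hr, hx⟩))
    (fun r hr x => hasDerivAt_mass hGhat hh h0 hG hr x) hA hB hint
    fun r hr x => hG.weingartenDefect_nonneg hr x

variable (hnonneg : 0 ≤ ∫ p, ricciDefect I h Ghat.inner (fun r => (G r).inner) p
    ∂((volume.restrict (openInterval a b)).prod (riemannianVolume I Ghat)))

include hnonneg

theorem limit_le_limit : massA ≤ massB := by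
  have := isFiniteMeasure_riemannianVolume Ghat
  obtain ⟨-, hsub⟩ := integrable_weingartenDefect_and_limit_sub_limit_eq hh h0 hG hab hA hB hint
  linarith [hG.integral_weingartenDefect_nonneg h (riemannianVolume I Ghat)]

theorem weingartenDefect_eq_zero_of_limits_eq (heq : massB = massA) :
    EqOn (weingartenDefect I h fun r => (G r).inner) 0 (openInterval a b ×ˢ univ) := by
  have := isFiniteMeasure_riemannianVolume Ghat
  have := isOpenPosMeasure_riemannianVolume Ghat
  obtain ⟨hdi, hsub⟩ := integrable_weingartenDefect_and_limit_sub_limit_eq hh h0 hG hab hA hB hint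
  refine eqOn_zero_of_integral_eq_zero (hG.continuousOn_weingartenDefect (hh.of_le one_le_two) h0)
    (fun r hr x => hG.weingartenDefect_nonneg hr x) hdi ?_
  linarith [hG.integral_weingartenDefect_nonneg h (riemannianVolume I Ghat)]

theorem limits_eq_iff_exists_eq_warped : massB = massA ↔ ∃ Gtilde : RiemMetric I N,
    ∀ r ∈ openInterval a b, ∀ x, (G r).inner x = warped I h Gtilde.inner r x :=
  ⟨fun heq => exists_eq_warped_of_weingartenDefect_eq_zero hh h0 hG hab
    (weingartenDefect_eq_zero_of_limits_eq hh h0 hG hab hA hB hint hnonneg heq),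
    fun ⟨_, hw⟩ => limits_eq_of_eq_warped hh h0 hG hab hA hB hw⟩

theorem limits_eq_iff_eq_warped_of_asymptoticAt {c : EReal} (hc : c ∈ Icc a b)
    (has : AsymptoticAt I a b c (fun r => (G r).inner) (warped I h Ghat.inner)) :
    massB = massA ↔ ∀ r ∈ openInterval a b, ∀ x,
      (G r).inner x = warped I h Ghat.inner r x := by
  have hiff := limits_eq_iff_exists_eq_warped hh h0 hG hab hA hB hint hnonneg
  refine ⟨fun heq r hr x => ?_, fun hw => hiff.2 ⟨Ghat, hw⟩⟩
  obtain ⟨Gtilde, hw⟩ := hiff.1 heq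
  rw [hw r hr x, warped, warped, eq_of_asymptoticAt_warped hab hc h0 (has.congr_left hw) x]

end

end Limits

end RadialMass

end

theorem mainTheorem4
    (n : ℕ) (hn : 2 ≤ n)
    {H : Type*} [TopologicalSpace H]
    (I : ModelWithCorners ℝ (EuclideanSpace ℝ (Fin (n - 1))) H)
    {N : Type*} [TopologicalSpace N] [ChartedSpace H N] [IsManifold I ∞ N]
    [T2Space N] [CompactSpace N] [MeasurableSpace N] [BorelSpace N]
    (a b : EReal) (hab : a < b)
    (h : ℝ → ℝ) (h_smooth : ContDiffOn ℝ ∞ h (RadialMass.openInterval a b))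
    (h_pos : ∀ r ∈ RadialMass.openInterval a b, 0 < h r)
    (Ghat : RadialMass.RiemMetric I N)
    (G : ℝ → RadialMass.RiemMetric I N)
    (G_smooth : RadialMass.SmoothFamily I a b (fun r => (G r).inner))
    (massA massB : ℝ)
    (h_massA : Tendsto (RadialMass.totalMass I h Ghat (fun r => (G r).inner))
      (RadialMass.nearIn a b a) (𝓝 massA))
    (h_massB : Tendsto (RadialMass.totalMass I h Ghat (fun r => (G r).inner))
      (RadialMass.nearIn a b b) (𝓝 massB))
    (h_integrable : Integrable (RadialMass.ricciDefect I h Ghat.inner (fun r => (G r).inner))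
      ((volume.restrict (RadialMass.openInterval a b)).prod (RadialMass.riemannianVolume I Ghat)))
    (h_nonneg : 0 ≤ ∫ p, RadialMass.ricciDefect I h Ghat.inner (fun r => (G r).inner) p
      ∂((volume.restrict (RadialMass.openInterval a b)).prod
        (RadialMass.riemannianVolume I Ghat))) :
    massA ≤ massB ∧
    (massB = massA ↔ ∃ Gtilde : RadialMass.RiemMetric I N,
      ∀ r ∈ RadialMass.openInterval a b, ∀ x : N,
        (G r).inner x = RadialMass.warped I h Gtilde.inner r x) ∧
    ((∃ r₀ ∈ Icc a b, RadialMass.AsymptoticAt I a b r₀ (fun r => (G r).inner)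
        (RadialMass.warped I h Ghat.inner)) →
      (massB = massA ↔ ∀ r ∈ RadialMass.openInterval a b, ∀ x : N,
        (G r).inner x = RadialMass.warped I h Ghat.inner r x)) := by
  have hh := h_smooth.of_le (ENat.LEInfty.out : (2 : WithTop ℕ∞) ≤ ∞)
  have h0 := fun r hr => (h_pos r hr).ne'
  have hG := RadialMass.metricFamily_of_smoothFamily G_smooth
  exact ⟨RadialMass.limit_le_limit hh h0 hG hab h_massA h_massB h_integrable h_nonneg,
    RadialMass.limits_eq_iff_exists_eq_warped hh h0 hG hab h_massA h_massB h_integrable h_nonneg,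
    fun ⟨_, hr₀, has⟩ => RadialMass.limits_eq_iff_eq_warped_of_asymptoticAt hh h0 hG hab h_massA
      h_massB h_integrable h_nonneg hr₀ has⟩
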